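/- **Setting.** Let $\mathcal A$ be an alphabet with $d\ge 2$ letters. An interval exchange map (i.e.m.) $T$ is given by irreducible combinatorial data $\pi=(\pi_t,\pi_b)$ (two bijections $\mathcal A\to\{1,\dots,d\}$ with $\pi_t^{-1}(\{1,\dots,k\})\ne\pi_b^{-1}(\{1,\dots,k\})$ for $1\le k<d$) and lengths $\lambda_\alpha>0$, $\alpha\in\mathcal A$. It acts on $I=(0,\sum_\alpha\lambda_\alpha)$ by exchanging the intervals $I_\alpha$ of length $\lambda_\alpha$, which are met in the order $\pi_t$ before the exchange and in the order $\pi_b$ after it; it is extended to the endpoints of the $I_\alpha$ by right-continuity. Let $u^t_1<\dots<u^t_{d-1}$ and $u^b_1<\dots<u^b_{d-1}$ be the points separating the intervals $I_\alpha$, respectively their images. $T$ has no connection if $T^m(u^b_j)\neq u^t_i$ for all $m\ge 0$ and all $1\le i,j<d$. Let $T=T^{(0)}$ have no connection, and let $T^{(n)}$, $n\ge 0$, be the i.e.m. obtained from $T$ by $n$ elementary steps of the Rauzy–Veech algorithm, with combinatorial data $\pi^{(n)}$, acting on $I^{(n)}$ and exchanging the intervals $I^{(n)}_\alpha$. The rotation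 number $\underline\gamma=\gamma_1\star\gamma_2\star\cdots$ of $T$ is the corresponding path in the Rauzy diagram, $\gamma_n$ being the arrow from $\pi^{(n-1)}$ to $\pi^{(n)}$. For $m\le n$ put $B(m,n)=B_{\gamma_n}\cdots B_{\gamma_{m+1}}$ (so $B(n,n)$ is the identity), where $B_\gamma=\mathbb I+E_{\alpha\beta}$ for an arrow $\gamma$ with loser $\alpha$ and winner $\beta$. Let $\|B\|=\max_\alpha\sum_\beta|B_{\alpha\beta}|$. Let $\Omega_\pi$ be the antisymmetric matrix with entries $\Omega_{\alpha\beta}=1$ if $\pi_t(\alpha)<\pi_t(\beta)$ and $\pi_b(\alpha)>\pi_b(\beta)$, $\Omega_{\alpha\beta}=-1$ if $\pi_t(\alpha)>\pi_t(\beta)$ and $\pi_b(\alpha)<\pi_b(\beta)$, and $\Omega_{\alpha\beta}=0$ otherwise. Let $\mathcal C(\pi)=\operatorname{Im}\Omega_\pi\cap(0,\infty)^{\mathcal A}$. Put $n_0=0$ and, for $k>0$, let $n_k$ be the smallest integer $n>n_{k-1}$ such that $$\overline{B(n_{k-1},n)\,\mathcal C(\pi^{(n_{k-1})})}\subset \mathcal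 C(\pi^{(n)})\cup\{0\}.$$ Condition (a'), which depends only on $\underline\gamma$, is: for every $\tau>0$ there is $C_\tau>0$ such that $\|B(n_{k-1},n_k)\|\le C_\tau\|B(n_0,n_{k-1})\|^\tau$ for all $k>0$. Let $s$ be the number of marked points of the translation surface obtained by suspension of $T$, that is, the number of classes of vertices of the suspension polygon (the polygon bounded by a top and a bottom line with common endpoints whose sides are labelled by $\mathcal A$ in the orders $\pi_t$ and $\pi_b$) after the two sides with the same label have been glued by translations, for all labels. **Statement.** Let $\underline\gamma$ be the rotation number of an i.e.m. with no connection, and assume that $\underline\gamma$ satisfies condition (a'). For every $\tau>0$ there is a constant $C_\tau>0$, depending only on $\underline\gamma$ and $\tau$, such that the following hold. 1. For all $\alpha\in\mathcal A$ and $n\ge 0$, $$\sum_{\beta\in\mathcal A}B_{\alpha\beta}(0,n)\ \ge\ C_\tau^{-1}\,\|B(0,n)\|^{1-\tau}.$$ 2. For every i.e.m. $T$ with no connection whose rotation number is $\underline\gamma$, all $\alpha\in\mathcal A$ and all $n\ge 0$, $$|I^{(n)}_\alpha|\ \le\ C_\tau\,|I^{(0)}|\,\|B(0,n)\|^{-1+\tau}.$$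 3. Suppose $s\ge 2$. For every i.e.m. $T$ with no connection whose rotation number is $\underline\gamma$, all $\alpha\in\mathcal A$ and all $\ell\ge 0$, there is a largest integer $k\ge\ell$ such that $\sum_\beta B_{\beta\alpha}(n_\ell,n_k)<s$, and for this $k$ $$|I^{(n_\ell)}_\alpha|\ \ge\ C_\tau^{-1}\,|I^{(0)}|\,\|B(0,n_k)\|^{-1-\tau}.$$ -/

import Mathlib

noncomputable section

namespace IntervalExchange

/-- Combinatorial data `(π_t, π_b)` on the alphabet `A` with `d` letters: two bijections of `A` with
the set of positions. Positions are numbered `0, …, d - 1` instead of `1, …, d`. -/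
structure CombData (A : Type*) [Fintype A] where
  /-- position in the top partition -/
  top : A ≃ Fin (Fintype.card A)
  /-- position in the bottom partition -/
  bot : A ≃ Fin (Fintype.card A)

/-- The two types of arrows of a Rauzy diagram. -/
inductive ArrowType
  | top
  | bot

namespace CombData

section

variable {A : Type*} [Fintype A]

/-- For `1 ≤ k < d`, the first `k` letters of the top row are not the first `k` letters of the
bottom row. -/
def Irreducible (π : CombData A) : Prop :=
  ∀ k : ℕ, 1 ≤ k → k < Fintype.card A →
    {α : A | (π.top α : ℕ) < k} ≠ {α : A | (π.bot α : ℕ) < k}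

/-- The antisymmetric matrix `Ω_π`. -/
def omega (π : CombData A) : Matrix A A ℝ := fun α β =>
  if π.top α < π.top β ∧ π.bot β < π.bot α then 1
  else if π.top β < π.top α ∧ π.bot α < π.bot β then -1
  else 0

/-- The subspace `H(π) ⊆ ℝ^A`, the image of `Ω_π`. -/
def H (π : CombData A) : Submodule ℝ (A → ℝ) := LinearMap.range π.omega.mulVecLin

/-- The cone `𝒞(π)`: the vectors of `H(π)` all of whose coordinates are positive. -/
def cone (π : CombData A) : Set (A → ℝ) := {v | v ∈ π.H ∧ ∀ α, 0 < v α}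

/-- The vertices of the polygon which is the suspension of an i.e.m. with combinatorial data `π`:
`Sum.inl i` is the vertex `U_i` of the top line, `Sum.inr i` the vertex `V_i` of the bottom line. -/
abbrev PolygonVertex (A : Type*) [Fintype A] : Type :=
  Fin (Fintype.card A + 1) ⊕ Fin (Fintype.card A + 1)

/-- Identifications between the vertices: the two lines have the same endpoints, and for each letter
`α` the side labelled `α` of the top line is glued by a translation to the side labelled `α` of the
bottom line. The top side labelled `α` goes from `U_i` to `U_{i+1}`, `i` the position of `α`
(counted from `0`) in the top row; in the same way for the bottom side. -/
inductive Glued (π : CombData A) : PolygonVertex A → PolygonVertex A → Prop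
  | start : Glued π (Sum.inl 0) (Sum.inr 0)
  | finish : Glued π (Sum.inl (Fin.last _)) (Sum.inr (Fin.last _))
  | left (α : A) : Glued π (Sum.inl (π.top α).castSucc) (Sum.inr (π.bot α).castSucc)
  | right (α : A) : Glued π (Sum.inl (π.top α).succ) (Sum.inr (π.bot α).succ)

/-- The set `Σ` of marked points of the suspended translation surface: the images of the vertices of
the polygon after gluing (`Quot` is the quotient by the equivalence relation generated by
`Glued`). -/
def MarkedPoint (π : CombData A) : Type := Quot π.Glued

/-- The number `s` of marked points. -/
def numMarkedPoints (π : CombData A) : ℕ := Nat.card π.MarkedPoint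

end

section

variable {A : Type*} [Fintype A] [Nontrivial A]

/-- The last letter `α_t` of the top row. -/
def lastTop (π : CombData A) : A := π.top.symm ⊤

/-- The last letter `α_b` of the bottom row. -/
def lastBot (π : CombData A) : A := π.bot.symm ⊤

/-- The end point of the arrow of the given type starting at `π`. For the top type this is
`R_t(π)`: the top row is unchanged, and in the bottom row the last letter `α_b` is moved to the place
just after `α_t` (the letters in between are shifted by one place to the right).
For the bottom type the roles of the two rows are exchanged. -/
def move (π : CombData A) : ArrowType → CombData A
  | .top => ⟨π.top, π.bot.trans (Fin.cycleIcc (π.bot π.lastTop + 1) ⊤)⟩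
  | .bot => ⟨π.top.trans (Fin.cycleIcc (π.top π.lastBot + 1) ⊤), π.bot⟩

/-- The winner of the arrow of the given type starting at `π`. -/
def winner (π : CombData A) : ArrowType → A
  | .top => π.lastTop
  | .bot => π.lastBot

/-- The loser of the arrow of the given type starting at `π`. -/
def loser (π : CombData A) : ArrowType → A
  | .top => π.lastBot
  | .bot => π.lastTop

/-- The matrix `B_γ = 𝕀 + E_{loser, winner}` of an arrow. -/
def arrowMatrix [DecidableEq A] (π : CombData A) (t : ArrowType) : Matrix A A ℝ :=
  1 + Matrix.single (π.loser t) (π.winner t) 1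

end

end CombData

/-- `‖B‖ = max_α ∑_β |B_{αβ}|`. -/
def matNorm {A : Type*} [Fintype A] (B : Matrix A A ℝ) : ℝ := ⨆ α, ∑ β, |B α β|

/-- An infinite path in a Rauzy diagram, given by its starting vertex and the types of its successive
arrows (`type n` is the type of the arrow `γ_{n+1}` from `π^{(n)}` to `π^{(n+1)}`). -/
structure RauzyPath (A : Type*) [Fintype A] where
  start : CombData A
  type : ℕ → ArrowType

namespace RauzyPath

variable {A : Type*} [Fintype A] [Nontrivial A]

/-- The vertices `π^{(n)}` of the path. -/
def vertex (γ : RauzyPath A) : ℕ → CombData A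
  | 0 => γ.start
  | n + 1 => (γ.vertex n).move (γ.type n)

variable [DecidableEq A]

/-- The matrix `B(m, n) = B_{γ_n} ⋯ B_{γ_{m+1}}` for `m ≤ n`; in particular `B(n, n) = 𝕀`. (For `m > n`
the value is `𝕀` too; it is not used.) -/
def B (γ : RauzyPath A) (m : ℕ) : ℕ → Matrix A A ℝ
  | 0 => 1
  | n + 1 => if m ≤ n then (γ.vertex n).arrowMatrix (γ.type n) * γ.B m n else 1

/-- `B(m, n)` maps `𝒞(π^{(m)})` into a set whose closure is contained in `𝒞(π^{(n)}) ∪ {0}`. -/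
def Contracts (γ : RauzyPath A) (m n : ℕ) : Prop :=
  closure ((γ.B m n).mulVec '' (γ.vertex m).cone) ⊆ (γ.vertex n).cone ∪ {0}

/-- The accelerated times: `n_0 = 0`, and `n_k` is the smallest integer `n > n_{k-1}` such that
`B(n_{k-1}, n)` satisfies `Contracts`. -/
def accTime (γ : RauzyPath A) : ℕ → ℕ
  | 0 => 0
  | k + 1 => sInf {n | γ.accTime k < n ∧ γ.Contracts (γ.accTime k) n}

/-- Condition (a'): for all `τ > 0` there is `C_τ > 0` such that, for all `k > 0`,
`‖B(n_{k-1}, n_k)‖ ≤ C_τ ‖B(n_0, n_{k-1})‖ ^ τ`. -/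
def ConditionA' (γ : RauzyPath A) : Prop :=
  ∀ τ : ℝ, 0 < τ → ∃ C : ℝ, 0 < C ∧ ∀ k : ℕ,
    matNorm (γ.B (γ.accTime k) (γ.accTime (k + 1))) ≤
      C * matNorm (γ.B (γ.accTime 0) (γ.accTime k)) ^ τ

end RauzyPath

/-- The data of an interval exchange map: combinatorial data and lengths `λ_α`. The map acts on
`I = (0, ∑ λ_α)`. The standing conditions on the data are in `IEM.Valid`. -/
structure IEM (A : Type*) [Fintype A] where
  comb : CombData A
  len : A → ℝ

namespace IEM

section

variable {A : Type*} [Fintype A]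

/-- The combinatorial data are irreducible and the lengths are positive. -/
def Valid (T : IEM A) : Prop := T.comb.Irreducible ∧ ∀ α, 0 < T.len α

/-- The length `|I|` of the interval on which `T` acts. -/
def totalLen (T : IEM A) : ℝ := ∑ α, T.len α

/-- The left endpoint of the interval `I_α^t`. -/
def leftTop (T : IEM A) (α : A) : ℝ :=
  ∑ β with T.comb.top β < T.comb.top α, T.len β

/-- The left endpoint of the interval `I_α^b`. -/
def leftBot (T : IEM A) (α : A) : ℝ :=
  ∑ β with T.comb.bot β < T.comb.bot α, T.len β

/-- The translation vector `δ = Ω_π λ`. -/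
def delta (T : IEM A) : A → ℝ := T.comb.omega.mulVec T.len

/-- The interval exchange map itself, extended to the singularities by right-continuity: on
`[left endpoint of I_α^t, right endpoint of I_α^t)` it is `x ↦ x + δ_α`. (Outside `[0, |I|)` it is the
identity; this is not used.) -/
def toFun (T : IEM A) (x : ℝ) : ℝ :=
  x + ∑ α, Set.indicator (Set.Ico (T.leftTop α) (T.leftTop α + T.len α)) (fun _ => T.delta α) x

/-- The singularities `u_1^t < ⋯ < u_{d-1}^t` of `T`: the left endpoints of the intervals of the top
partition other than the first one. -/
def singTop (T : IEM A) : Set ℝ := {x | ∃ α, 0 < (T.comb.top α : ℕ) ∧ x = T.leftTop α}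

/-- The singularities `u_1^b < ⋯ < u_{d-1}^b` of `T⁻¹`. -/
def singBot (T : IEM A) : Set ℝ := {x | ∃ α, 0 < (T.comb.bot α : ℕ) ∧ x = T.leftBot α}

/-- `T` has no connection: `T^m (u_j^b) = u_i^t` never holds, for `m ≥ 0`. -/
def NoConnection (T : IEM A) : Prop :=
  ∀ u ∈ T.singBot, ∀ v ∈ T.singTop, ∀ m : ℕ, T.toFun^[m] u ≠ v

end

section

variable {A : Type*} [Fintype A] [Nontrivial A]

open scoped Classical in
/-- The type of the elementary step of the Rauzy–Veech algorithm at `T`: it is top if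
`u_{d-1}^t < u_{d-1}^b`, that is `|I| - λ_{α_t} < |I| - λ_{α_b}`, and bottom otherwise (`T` having
no connection, the two points are different). -/
def stepType (T : IEM A) : ArrowType :=
  if T.len T.comb.lastBot < T.len T.comb.lastTop then .top else .bot

variable [DecidableEq A]

/-- The elementary step of the Rauzy–Veech algorithm: the first return map to
`(0, max (u_{d-1}^t, u_{d-1}^b))`. The length of the loser is subtracted from the length of the
winner. -/
def step (T : IEM A) : IEM A where
  comb := T.comb.move T.stepType
  len := Function.update T.len (T.comb.winner T.stepType)
    (T.len (T.comb.winner T.stepType) - T.len (T.comb.loser T.stepType))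

/-- The i.e.m. `T^{(n)}`, obtained from `T` by `n` elementary steps. The subinterval `I_α^{(n)}` has
length `(T.iter n).len α`, and `I^{(n)}` has length `(T.iter n).totalLen`. -/
def iter (T : IEM A) (n : ℕ) : IEM A := step^[n] T

/-- The rotation number of `T`: the path of the Rauzy diagram followed by the algorithm. -/
def rotationNumber (T : IEM A) : RauzyPath A where
  start := T.comb
  type n := (T.iter n).stepType

end

end IEM

/-- `γ` is the rotation number of the i.e.m. `T`, which has no connection. -/
def RauzyPath.IsRotationNumberOf {A : Type*} [Fintype A] [DecidableEq A] [Nontrivial A]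
    (γ : RauzyPath A) (T : IEM A) : Prop :=
  T.Valid ∧ T.NoConnection ∧ T.rotationNumber = γ

end IntervalExchange

end

/-! Two consequences of `Contracts` carry the theorem. Let w range over the nonnegative vectors of
H(π). The slice ∑ w = 1 is a polytope with rational vertices, so a vector f of natural numbers which
is positive on all nonzero w satisfies f·w ≥ c ∑ w, with c depending on the alphabet only
(`exists_uniform_lower_bound`). The rows of B(n_k, n_{k+1}) are such f, whence every row sum of B(0,
n_{k+1}) is at least a constant times ‖B(0, n_k)‖ (`exists_le_sum_B`). Condition (a') gives ‖B(0,
n_{k+2})‖ ≤ C ‖B(0, n_k)‖^(1+τ) (`exists_matNorm_le`), and estimate 1 follows. It implies estimate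
2, because |I^(0)| is the sum of the |I^(n)_α| weighted by the row sums of B(0, n).

For estimate 3, the sides of the polygon are the edges of a directed graph on the s marked points.
Column α of B(n_ℓ, n) is a flow of value one between the end points of side α; once its total
reaches s it contains a nonzero circulation. Vectors of ker Ω are differences of potentials, so
circulations are orthogonal to ker Ω and lie in H(π); a contracting matrix makes them positive
(`Contracts.one_le_B`). Hence column α of B(n_ℓ, n_{k+2}) is positive, |I^(n_ℓ)_α| ≥ |I^(n_{k+2})| ≥
|I^(0)| / ‖B(0, n_{k+2})‖, and the growth bound applies again.

The times n_k exist because absence of connections is inherited by each step: every letter then wins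
infinitely often (`Valid.frequently_winnerAt`), which makes B(m, n) positive for large n. -/

noncomputable section

/-! ### Combinatorics of one Rauzy move. -/

namespace IntervalExchange

/-- The other type of arrow. -/
def ArrowType.flip : ArrowType → ArrowType
  | .top => .bot
  | .bot => .top

namespace CombData

section

variable {A : Type*} [Fintype A]

/-- The position of a letter in one of the two rows. -/
def pos (π : CombData A) : ArrowType → A → ℕ
  | .top, α => π.top α
  | .bot, α => π.bot α

lemma pos_lt (π : CombData A) (r : ArrowType) (α : A) : π.pos r α < Fintype.card A := by
  cases r
  · exact (π.top α).isLt
  · exact (π.bot α).isLt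

lemma pos_injective (π : CombData A) (r : ArrowType) : Function.Injective (π.pos r) := by
  intro α β h
  cases r
  · exact π.top.injective (Fin.ext h)
  · exact π.bot.injective (Fin.ext h)

lemma pos_inj (π : CombData A) (r : ArrowType) {α β : A} : π.pos r α = π.pos r β ↔ α = β :=
  (π.pos_injective r).eq_iff

lemma exists_pos_eq (π : CombData A) (r : ArrowType) {k : ℕ} (hk : k < Fintype.card A) :
    ∃ α, π.pos r α = k := by
  cases r
  · exact ⟨π.top.symm ⟨k, hk⟩, by simp [pos]⟩
  · exact ⟨π.bot.symm ⟨k, hk⟩, by simp [pos]⟩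

lemma not_irreducible_of_forall_iff {π : CombData A} (t : ArrowType) {k : ℕ} (h1 : 1 ≤ k)
    (hk : k < Fintype.card A) (h : ∀ α, π.pos t α < k ↔ π.pos t.flip α < k) :
    ¬ π.Irreducible := by
  intro hi
  refine hi k h1 hk (Set.ext fun α => ?_)
  cases t
  · exact h α
  · exact (h α).symm

/-- The total length of the letters which precede `α` in a row. -/
def left (π : CombData A) (r : ArrowType) (x : A → ℝ) (α : A) : ℝ :=
  ∑ β with π.pos r β < π.pos r α, x β

/-- Only letters lying on different sides of α in the two rows contribute to the difference.
Identities for Ω thus become identities for left endpoints. -/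
lemma omega_mulVec_apply (π : CombData A) (x : A → ℝ) (α : A) :
    π.omega.mulVec x α = π.left .bot x α - π.left .top x α := by
  simp only [Matrix.mulVec, dotProduct, left, Finset.sum_filter, ← Finset.sum_sub_distrib]
  refine Finset.sum_congr rfl fun β _ => ?_
  have h1 : π.top α = π.top β ↔ α = β := π.top.injective.eq_iff
  have h2 : π.bot α = π.bot β ↔ α = β := π.bot.injective.eq_iff
  simp only [omega, pos, Fin.lt_def, Fin.ext_iff] at *
  by_cases h : α = β
  · subst h; simp
  · have h1' : (π.top α : ℕ) ≠ π.top β := fun e => h (h1.1 e)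
    have h2' : (π.bot α : ℕ) ≠ π.bot β := fun e => h (h2.1 e)
    rcases lt_or_gt_of_ne h1' with a | a <;> rcases lt_or_gt_of_ne h2' with b | b <;>
      simp [a, b, a.not_gt, b.not_gt]

end

section

variable {A : Type*} [Fintype A] [Nontrivial A] (π : CombData A) (t : ArrowType)

lemma pos_winner : π.pos t (π.winner t) = Fintype.card A - 1 := by
  cases t <;> simp [pos, winner, lastTop, lastBot, Fin.val_top]

lemma pos_loser : π.pos t.flip (π.loser t) = Fintype.card A - 1 := by
  cases t <;> simp [pos, loser, lastTop, lastBot, Fin.val_top, ArrowType.flip]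

lemma loser_eq_winner_flip : π.loser t = π.winner t.flip := by cases t <;> rfl

lemma pos_le_winner (α : A) : π.pos t α ≤ π.pos t (π.winner t) := by
  rw [pos_winner]; have := π.pos_lt t α; omega

lemma pos_le_loser (α : A) : π.pos t.flip α ≤ π.pos t.flip (π.loser t) := by
  rw [pos_loser]; have := π.pos_lt t.flip α; omega

variable {π}

lemma Irreducible.winner_ne_loser (h : π.Irreducible) : π.winner t ≠ π.loser t := by
  intro e
  have hd : 1 < Fintype.card A := Fintype.one_lt_card
  refine not_irreducible_of_forall_iff (π := π) t (k := Fintype.card A - 1)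
    (by omega) (by omega) (fun α => ?_) h
  have h1 : π.pos t α = Fintype.card A - 1 ↔ α = π.winner t := by
    rw [← π.pos_winner t]; exact π.pos_inj t
  have h2 : π.pos t.flip α = Fintype.card A - 1 ↔ α = π.winner t := by
    rw [e, ← π.pos_loser t]; exact π.pos_inj t.flip
  have := π.pos_lt t α
  have := π.pos_lt t.flip α
  have : π.pos t α = Fintype.card A - 1 ↔ π.pos t.flip α = Fintype.card A - 1 := h1.trans h2.symm
  omega

lemma pos_move_same (α : A) : (π.move t).pos t α = π.pos t α := by
  cases t <;> rfl

lemma val_cycleIcc_succ_top {n : ℕ} [NeZero n] (j k : Fin n) (hj : (j : ℕ) < n - 1) :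
    (Fin.cycleIcc (j + 1) ⊤ k : ℕ) =
      if (k : ℕ) ≤ j then (k : ℕ) else if (k : ℕ) = n - 1 then j + 1 else k + 1 := by
  -- The bound j < n - 1 prevents the sum in `Fin n` from wrapping around.
  have hj1 : ((j + 1 : Fin n) : ℕ) = j + 1 := by
    rw [Fin.val_add, Fin.val_one', Nat.add_mod_mod, Nat.mod_eq_of_lt (by omega)]
  have hk := k.isLt
  split_ifs with h1 h2
  · rw [Fin.cycleIcc_of_lt (by rw [Fin.lt_def]; omega)]
  · have : k = ⊤ := Fin.ext (by rw [Fin.val_top]; exact h2)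
    rw [this, Fin.cycleIcc_of_last le_top, hj1]
  · rw [Fin.cycleIcc_of_ge_of_lt (by rw [Fin.le_def]; omega)
      (by rw [Fin.lt_def, Fin.val_top]; omega)]
    rw [Fin.val_add, Fin.val_one', Nat.add_mod_mod, Nat.mod_eq_of_lt (by omega)]

lemma Irreducible.pos_winner_lt_loser (h : π.Irreducible) :
    π.pos t.flip (π.winner t) < π.pos t.flip (π.loser t) :=
  lt_of_le_of_ne (π.pos_le_loser t _) fun e => h.winner_ne_loser t ((π.pos_inj _).1 e)

lemma Irreducible.pos_move_flip [DecidableEq A] (h : π.Irreducible) (α : A) :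
    (π.move t).pos t.flip α =
      if π.pos t.flip α ≤ π.pos t.flip (π.winner t) then π.pos t.flip α
      else if α = π.loser t then π.pos t.flip (π.winner t) + 1 else π.pos t.flip α + 1 := by
  have hw := h.pos_winner_lt_loser t
  have hl : α = π.loser t ↔ π.pos t.flip α = Fintype.card A - 1 := by
    rw [← π.pos_loser t, π.pos_inj]
  rw [pos_loser] at hw
  simp only [hl]
  cases t
  · exact val_cycleIcc_succ_top (π.bot π.lastTop) (π.bot α) hw
  · exact val_cycleIcc_succ_top (π.top π.lastBot) (π.top α) hw

/-- The winner is last in row `t`, so it is outside a common initial block of k < d letters. In the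
other row the block then lies to the left of the winner, where the move changes nothing. -/
lemma Irreducible.move (h : π.Irreducible) : (π.move t).Irreducible := by
  classical
  by_contra hn
  simp only [Irreducible, not_forall, not_not] at hn
  obtain ⟨k, h1, hk, he⟩ := hn
  have he' : ∀ α, (π.move t).pos t α < k ↔ (π.move t).pos t.flip α < k := by
    intro α
    have := Set.ext_iff.1 he α
    cases t
    · exact this
    · exact this.symm
  refine not_irreducible_of_forall_iff (π := π) t h1 hk (fun α => ?_) h
  have hw := he' (π.winner t)
  have hα := he' α
  rw [pos_move_same, h.pos_move_flip] at hw hα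
  rw [pos_winner, if_pos le_rfl] at hw
  have := h.pos_winner_lt_loser t
  split_ifs at hα <;> omega

lemma left_winner (x : A → ℝ) : π.left t x (π.winner t) = ∑ α, x α - x (π.winner t) := by
  rw [left, eq_sub_iff_add_eq, ← Finset.sum_filter_add_sum_filter_not Finset.univ
    (fun β => π.pos t β < π.pos t (π.winner t))]
  congr 1
  have : (Finset.univ.filter fun β => ¬ π.pos t β < π.pos t (π.winner t)) = {π.winner t} := by
    ext β
    have := π.pos_le_winner t β
    simp only [Finset.mem_filter, Finset.mem_univ, true_and, Finset.mem_singleton]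
    rw [← π.pos_inj t]
    omega
  rw [this, Finset.sum_singleton]

lemma left_loser (x : A → ℝ) :
    π.left t.flip x (π.loser t) = ∑ α, x α - x (π.loser t) := by
  rw [loser_eq_winner_flip, left_winner]

/-- The lengths after an elementary step of type `t`. -/
def stepLen [DecidableEq A] (π : CombData A) (t : ArrowType) (x : A → ℝ) : A → ℝ :=
  Function.update x (π.winner t) (x (π.winner t) - x (π.loser t))

variable [DecidableEq A]

lemma stepLen_eq (x : A → ℝ) (β : A) : π.stepLen t x β =
    x β - if β = π.winner t then x (π.loser t) else 0 := by
  rw [stepLen, Function.update_apply]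
  split_ifs with h <;> simp [h]

lemma sum_filter_stepLen (x : A → ℝ) (p : A → Prop) [DecidablePred p] :
    ∑ β with p β, π.stepLen t x β =
      (∑ β with p β, x β) - if p (π.winner t) then x (π.loser t) else 0 := by
  simp only [stepLen_eq, Finset.sum_sub_distrib]
  congr 1
  rw [Finset.sum_ite_eq']
  simp

lemma left_move_same (x : A → ℝ) (α : A) :
    (π.move t).left t (π.stepLen t x) α = π.left t x α := by
  simp only [left, pos_move_same]
  rw [sum_filter_stepLen, if_neg (π.pos_le_winner t α).not_gt, sub_zero]

/-- To the right of the winner, its loss of length is compensated by the loser, which is inserted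
before α. -/
lemma Irreducible.left_move_flip (h : π.Irreducible) (x : A → ℝ) {α : A} (hα : α ≠ π.loser t) :
    (π.move t).left t.flip (π.stepLen t x) α = π.left t.flip x α := by
  simp only [left]
  rw [sum_filter_stepLen]
  have hw := h.pos_winner_lt_loser t
  simp only [h.pos_move_flip, if_pos le_rfl, if_neg hα]
  by_cases h1 : π.pos t.flip α ≤ π.pos t.flip (π.winner t)
  · rw [if_pos h1, if_neg h1.not_gt, sub_zero]
    refine Finset.sum_congr (Finset.filter_congr fun β _ => ?_) fun _ _ => rfl
    split_ifs <;> omega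
  · rw [if_neg h1, if_pos (by omega)]
    have : (Finset.univ.filter fun β => (if π.pos t.flip β ≤ π.pos t.flip (π.winner t) then
        π.pos t.flip β else if β = π.loser t then π.pos t.flip (π.winner t) + 1
        else π.pos t.flip β + 1) < π.pos t.flip α + 1) =
        insert (π.loser t) (Finset.univ.filter fun β => π.pos t.flip β < π.pos t.flip α) := by
      ext β
      simp only [Finset.mem_filter, Finset.mem_univ, true_and, Finset.mem_insert]
      by_cases hβ : β = π.loser t
      · subst hβ
        simp [hw.not_ge]
        omega
      · simp only [hβ, if_false, false_or]
        split_ifs <;> omega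
    rw [this, Finset.sum_insert]
    · ring
    · simp [π.pos_le_loser t α]

lemma Irreducible.left_move_loser (h : π.Irreducible) (x : A → ℝ) :
    (π.move t).left t.flip (π.stepLen t x) (π.loser t) =
      π.left t.flip x (π.winner t) + x (π.winner t) - x (π.loser t) := by
  simp only [left]
  rw [sum_filter_stepLen]
  have hw := h.pos_winner_lt_loser t
  simp only [h.pos_move_flip, if_pos le_rfl, if_neg hw.not_ge, if_true]
  rw [if_pos (by omega)]
  have : (Finset.univ.filter fun β => (if π.pos t.flip β ≤ π.pos t.flip (π.winner t) then
      π.pos t.flip β else if β = π.loser t then π.pos t.flip (π.winner t) + 1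
      else π.pos t.flip β + 1) < π.pos t.flip (π.winner t) + 1) =
      insert (π.winner t)
        (Finset.univ.filter fun β => π.pos t.flip β < π.pos t.flip (π.winner t)) := by
    ext β
    simp only [Finset.mem_filter, Finset.mem_univ, true_and, Finset.mem_insert]
    by_cases hβ : β = π.winner t
    · subst hβ
      simp
    · have : π.pos t.flip β ≠ π.pos t.flip (π.winner t) := fun e => hβ ((π.pos_inj _).1 e)
      simp only [hβ, false_or]
      split_ifs <;> omega
  rw [this, Finset.sum_insert (by simp)]
  ring

lemma arrowMatrix_mulVec (x : A → ℝ) (α : A) :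
    (π.arrowMatrix t).mulVec x α = x α + if α = π.loser t then x (π.winner t) else 0 := by
  rw [arrowMatrix, Matrix.add_mulVec, Matrix.one_mulVec, Pi.add_apply, Matrix.single_mulVec]
  congr 1
  simp [Function.update_apply]

/-- The relation `Ω_{π'} ᵗB⁻¹ = B Ω_π`. -/
lemma Irreducible.omega_move (h : π.Irreducible) (x : A → ℝ) :
    (π.move t).omega.mulVec (π.stepLen t x) = (π.arrowMatrix t).mulVec (π.omega.mulVec x) := by
  funext α
  rw [arrowMatrix_mulVec]
  simp only [omega_mulVec_apply]
  have h1 := left_move_same (π := π) t x α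
  have h2 : α ≠ π.loser t → _ := h.left_move_flip t x
  have h3 := h.left_move_loser t x
  have h4 := left_winner (π := π) t x
  have h5 := left_loser (π := π) t x
  by_cases hα : α = π.loser t
  · subst hα
    rw [if_pos rfl]
    cases t <;> simp only [ArrowType.flip] at * <;> linarith
  · rw [if_neg hα]
    have h2 := h2 hα
    cases t <;> simp only [ArrowType.flip] at * <;> linarith

lemma sum_stepLen (x : A → ℝ) : ∑ α, π.stepLen t x α = ∑ α, x α - x (π.loser t) := by
  simpa using sum_filter_stepLen (π := π) t x (fun _ => True)

end

end CombData

/-! ### Absence of connections is inherited by the elementary step. -/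

namespace CombData

variable {A : Type*} [Fintype A] (π : CombData A) (r : ArrowType) {x : A → ℝ}

lemma left_nonneg (hx : ∀ α, 0 ≤ x α) (α : A) : 0 ≤ π.left r x α :=
  Finset.sum_nonneg fun β _ => hx β

lemma left_add_eq (x : A → ℝ) (α : A) :
    π.left r x α + x α = ∑ β with π.pos r β ≤ π.pos r α, x β := by
  classical
  have : (Finset.univ.filter fun β => π.pos r β ≤ π.pos r α) =
      insert α (Finset.univ.filter fun β => π.pos r β < π.pos r α) := by
    ext β
    simp only [Finset.mem_filter, Finset.mem_univ, true_and, Finset.mem_insert]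
    rw [← π.pos_inj r]
    omega
  rw [this, Finset.sum_insert (by simp), left, add_comm]

lemma left_add_le (hx : ∀ α, 0 ≤ x α) {α β : A} (h : π.pos r α < π.pos r β) :
    π.left r x α + x α ≤ π.left r x β := by
  rw [left_add_eq]
  refine Finset.sum_le_sum_of_subset_of_nonneg (fun γ hγ => ?_) fun γ _ _ => hx γ
  simp only [Finset.mem_filter, Finset.mem_univ, true_and] at hγ ⊢
  omega

lemma left_add_le_sum (hx : ∀ α, 0 ≤ x α) (α : A) : π.left r x α + x α ≤ ∑ β, x β := by
  rw [left_add_eq]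
  exact Finset.sum_le_sum_of_subset_of_nonneg (Finset.filter_subset _ _) fun γ _ _ => hx γ

lemma exists_mem_Ico_left [Nonempty A] {y : ℝ} (h0 : 0 ≤ y) (hy : y < ∑ α, x α) :
    ∃ α, y ∈ Set.Ico (π.left r x α) (π.left r x α + x α) := by
  have hd : 0 < Fintype.card A := Fintype.card_pos
  obtain ⟨α₀, hα₀⟩ := π.exists_pos_eq r hd
  have hne : (Finset.univ.filter fun α => π.left r x α ≤ y).Nonempty :=
    ⟨α₀, Finset.mem_filter.2 ⟨Finset.mem_univ _, by simpa [left, hα₀] using h0⟩⟩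
  obtain ⟨α, hα, hmax⟩ := Finset.exists_max_image _ (π.pos r) hne
  simp only [Finset.mem_filter, Finset.mem_univ, true_and] at hα hmax
  refine ⟨α, hα, ?_⟩
  rw [left_add_eq]
  by_cases h : π.pos r α + 1 < Fintype.card A
  · obtain ⟨β, hβ⟩ := π.exists_pos_eq r h
    have h1 : ¬ π.left r x β ≤ y := fun h1 => by have := hmax β h1; omega
    rw [not_le] at h1
    refine h1.trans_eq (Finset.sum_congr (Finset.filter_congr fun γ _ => ?_) fun _ _ => rfl)
    omega
  · refine hy.trans_eq (Finset.sum_congr (Eq.symm ?_) fun _ _ => rfl)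
    refine Finset.filter_true_of_mem fun γ _ => ?_
    have := π.pos_lt r γ
    omega

end CombData

namespace IEM

section

variable {A : Type*} [Fintype A] {T : IEM A}

lemma Valid.nonneg (h : T.Valid) (α : A) : 0 ≤ T.len α := (h.2 α).le

lemma delta_eq (T : IEM A) (α : A) :
    T.delta α = T.comb.left .bot T.len α - T.comb.left .top T.len α :=
  T.comb.omega_mulVec_apply T.len α

lemma Valid.toFun_of_mem (h : T.Valid) {x : ℝ} {α : A} (h1 : T.comb.left .top T.len α ≤ x)
    (h2 : x < T.comb.left .top T.len α + T.len α) : T.toFun x = x + T.delta α := by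
  rw [toFun, Finset.sum_eq_single α]
  · rw [Set.indicator_of_mem]
    exact ⟨h1, h2⟩
  · intro β _ hβ
    refine Set.indicator_of_notMem (fun hm => ?_) _
    have hm1 : T.comb.left .top T.len β ≤ x := hm.1
    have hm2 : x < T.comb.left .top T.len β + T.len β := hm.2
    rcases lt_trichotomy (T.comb.pos .top α) (T.comb.pos .top β) with c | c | c
    · have := T.comb.left_add_le .top h.nonneg c
      linarith
    · exact hβ ((T.comb.pos_inj _).1 c.symm)
    · have := T.comb.left_add_le .top h.nonneg c
      linarith
  · simp

lemma mem_singTop {x : ℝ} :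
    x ∈ T.singTop ↔ ∃ α, 0 < T.comb.pos .top α ∧ x = T.comb.left .top T.len α := Iff.rfl

lemma mem_singBot {x : ℝ} :
    x ∈ T.singBot ↔ ∃ α, 0 < T.comb.pos .bot α ∧ x = T.comb.left .bot T.len α := Iff.rfl

end

variable {A : Type*} [Fintype A] [Nontrivial A] {T : IEM A}

lemma card_sub_one_pos (A : Type*) [Fintype A] [Nontrivial A] : 0 < Fintype.card A - 1 := by
  have : 1 < Fintype.card A := Fintype.one_lt_card
  omega

lemma len_loser_le_winner (T : IEM A) :
    T.len (T.comb.loser T.stepType) ≤ T.len (T.comb.winner T.stepType) := by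
  rw [stepType]
  split_ifs with h
  · exact h.le
  · exact not_lt.1 h

/-- Equal lengths would make the last singularities of the two partitions coincide: a connection
with m = 0. -/
lemma NoConnection.len_loser_lt_winner (h : T.NoConnection) :
    T.len (T.comb.loser T.stepType) < T.len (T.comb.winner T.stepType) := by
  refine lt_of_le_of_ne T.len_loser_le_winner fun e => ?_
  have e' : T.len (T.comb.winner .top) = T.len (T.comb.winner .bot) := by
    rw [CombData.loser_eq_winner_flip] at e
    cases ht : T.stepType <;> rw [ht] at e
    · exact e.symm
    · exact e
  have hpos := card_sub_one_pos A
  refine h (T.comb.left .bot T.len (T.comb.winner .bot)) ⟨_, ?_, rfl⟩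
    (T.comb.left .top T.len (T.comb.winner .top)) ⟨_, ?_, rfl⟩ 0 ?_
  · exact hpos.trans_eq (T.comb.pos_winner .bot).symm
  · exact hpos.trans_eq (T.comb.pos_winner .top).symm
  · rw [CombData.left_winner, CombData.left_winner, e']
    rfl

lemma Valid.toFun_left_loser_of_top (h : T.Valid) (hc : T.NoConnection)
    (ht : T.stepType = .top) {x : ℝ} (h1 : T.totalLen - T.len (T.comb.loser .top) ≤ x)
    (h2 : x < T.totalLen) : T.toFun x = x + T.delta (T.comb.winner .top) := by
  have hlt := hc.len_loser_lt_winner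
  rw [ht] at hlt
  have hl := T.comb.left_winner .top T.len
  rw [totalLen] at h1 h2
  exact h.toFun_of_mem (by linarith) (by linarith)

variable [DecidableEq A]

lemma step_comb (T : IEM A) : T.step.comb = T.comb.move T.stepType := rfl

lemma step_len (T : IEM A) : T.step.len = T.comb.stepLen T.stepType T.len := rfl

lemma totalLen_step (T : IEM A) :
    T.step.totalLen = T.totalLen - T.len (T.comb.loser T.stepType) :=
  CombData.sum_stepLen _ _

lemma step_len_apply (T : IEM A) (β : A) : T.step.len β =
    T.len β - if β = T.comb.winner T.stepType then T.len (T.comb.loser T.stepType) else 0 :=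
  CombData.stepLen_eq _ _ _

lemma delta_step (h : T.comb.Irreducible) (α : A) : T.step.delta α =
    T.delta α + if α = T.comb.loser T.stepType then T.delta (T.comb.winner T.stepType) else 0 := by
  rw [delta, step_comb, step_len, h.omega_move, CombData.arrowMatrix_mulVec]
  rfl

lemma Valid.step (h : T.Valid) (hc : T.NoConnection) : T.step.Valid := by
  refine ⟨h.1.move _, fun α => ?_⟩
  have h1 := hc.len_loser_lt_winner
  have h2 := h.2 α
  rw [step_len_apply]
  split_ifs with e
  · rw [e]; linarith
  · linarith

/-- After a bottom step the loser occupies the right end of the winner's old interval, which `T`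
sends onto the loser's old interval; the return takes two iterates. -/
lemma Valid.toFun_toFun_of_bot (h : T.Valid) (hc : T.NoConnection) (ht : T.stepType = .bot)
    {x : ℝ} (h1 : T.step.comb.left .top T.step.len (T.comb.loser .bot) ≤ x)
    (h2 : x < T.step.comb.left .top T.step.len (T.comb.loser .bot) + T.len (T.comb.loser .bot)) :
    T.toFun x = T.comb.left .top T.len (T.comb.loser .bot) +
      (x - T.step.comb.left .top T.step.len (T.comb.loser .bot)) ∧
    T.toFun (T.toFun x) =
      x + (T.delta (T.comb.loser .bot) + T.delta (T.comb.winner .bot)) := by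
  have hlt := hc.len_loser_lt_winner
  rw [ht] at hlt
  rw [step_comb, step_len, ht] at *
  have e1 := h.1.left_move_loser .bot T.len
  have e2 := T.comb.left_winner .bot T.len
  have e3 := T.comb.left_loser .bot T.len
  have e4 := T.delta_eq (T.comb.winner .bot)
  simp only [ArrowType.flip] at e1 e3
  have hx : T.toFun x = x + T.delta (T.comb.winner .bot) :=
    h.toFun_of_mem (by linarith) (by linarith)
  refine ⟨by rw [hx]; linarith, ?_⟩
  rw [h.toFun_of_mem (α := T.comb.loser .bot), hx]
  · ring
  · rw [hx]; linarith
  · rw [hx]; linarith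

/-- The step is an induced map, with return time two on the loser and one elsewhere. Only the
inclusion of its orbits in those of `T` is needed. -/
lemma Valid.toFun_step (h : T.Valid) (hc : T.NoConnection) {x : ℝ} (h0 : 0 ≤ x)
    (hx : x < T.step.totalLen) :
    (0 ≤ T.step.toFun x ∧ T.step.toFun x < T.step.totalLen) ∧
      ∃ j, T.step.toFun x = T.toFun^[j] x := by
  have h' := h.step hc
  obtain ⟨α, h1, h2⟩ := T.step.comb.exists_mem_Ico_left .top h0 hx
  have e := h'.toFun_of_mem h1 h2
  have hn := T.step.comb.left_nonneg .bot h'.nonneg α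
  have hs := T.step.comb.left_add_le_sum .bot h'.nonneg α
  rw [e]
  refine ⟨?_, ?_⟩
  · rw [delta_eq]
    rw [totalLen] at *
    constructor <;> linarith
  rw [delta_step h.1]
  have hle : T.step.len α ≤ T.len α := by
    rw [step_len_apply]
    have := h.2 (T.comb.loser T.stepType)
    split_ifs <;> linarith
  have hlt := hc.len_loser_lt_winner
  by_cases hα : α = T.comb.loser T.stepType
  · rw [if_pos hα]
    refine ⟨2, ?_⟩
    subst hα
    simp only [Function.iterate_succ, Function.iterate_zero, Function.comp, id]
    cases ht : T.stepType
    · have e1 := CombData.left_move_same (π := T.comb) .top T.len (T.comb.loser .top)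
      rw [step_comb, step_len, ht, e1] at h1 h2
      rw [step_len, ht] at hle
      rw [ht] at hlt
      have e2 := T.comb.left_loser .top T.len
      have e3 := T.delta_eq (T.comb.loser .top)
      simp only [ArrowType.flip] at e2
      have hx : T.toFun x = x + T.delta (T.comb.loser .top) :=
        h.toFun_of_mem h1 (by linarith)
      rw [h.toFun_left_loser_of_top hc ht, hx]
      · ring
      · rw [hx, totalLen]; linarith
      · rw [hx, totalLen]; linarith
    · rw [ht] at h1 h2 hle
      rw [(h.toFun_toFun_of_bot hc ht h1 (by linarith)).2]
  · rw [if_neg hα, add_zero]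
    refine ⟨1, ?_⟩
    have e1 : T.step.comb.left .top T.step.len α = T.comb.left .top T.len α := by
      rw [step_comb, step_len]
      cases ht : T.stepType
      · exact CombData.left_move_same _ _ _
      · rw [ht] at hα
        exact h.1.left_move_flip .bot _ hα
    rw [Function.iterate_one, h.toFun_of_mem] <;> linarith

lemma Valid.iterate_toFun_step (h : T.Valid) (hc : T.NoConnection) (m : ℕ) {x : ℝ} (h0 : 0 ≤ x)
    (hx : x < T.step.totalLen) : ∃ j, T.step.toFun^[m] x = T.toFun^[j] x := by
  induction m generalizing x with
  | zero => exact ⟨0, rfl⟩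
  | succ m ih =>
    obtain ⟨⟨h1, h2⟩, j, hj⟩ := h.toFun_step hc h0 hx
    obtain ⟨i, hi⟩ := ih h1 h2
    exact ⟨i + j, by rw [Function.iterate_succ_apply, hi, hj, ← Function.iterate_add_apply]⟩

lemma pos_of_pos_move {π : CombData A} (h : π.Irreducible) {t r : ArrowType} {α : A}
    (hα : 0 < (π.move t).pos r α) (hr : r = t.flip → α ≠ π.loser t) : 0 < π.pos r α := by
  by_cases e : r = t
  · subst e
    rwa [CombData.pos_move_same] at hα
  · have e' : r = t.flip := by cases r <;> cases t <;> simp_all [ArrowType.flip]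
    subst e'
    rw [h.pos_move_flip] at hα
    have := h.pos_winner_lt_loser t
    split_ifs at hα with h1 h2
    · exact hα
    · exact absurd h2 (hr rfl)
    · omega

/-- The only new bottom endpoint is that of the loser of a top step; it is the image under `T` of
the last old one. -/
lemma Valid.exists_of_mem_singBot_step (h : T.Valid) (hc : T.NoConnection) {u : ℝ}
    (hu : u ∈ T.step.singBot) : ∃ u₀ ∈ T.singBot, ∃ j, u = T.toFun^[j] u₀ := by
  obtain ⟨α, hα, rfl⟩ := mem_singBot.1 hu
  rw [step_comb] at hα
  have hlt := hc.len_loser_lt_winner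
  have hd := card_sub_one_pos A
  rw [step_comb, step_len]
  cases ht : T.stepType <;> rw [ht] at hα hlt
  · by_cases e : α = T.comb.loser .top
    · subst e
      have e1 := h.1.left_move_loser .top T.len
      have e2 := T.comb.left_loser .top T.len
      have e3 := T.comb.left_winner .top T.len
      have e4 := T.delta_eq (T.comb.winner .top)
      have e5 := h.2 (T.comb.loser .top)
      simp only [ArrowType.flip] at e1 e2
      refine ⟨_, mem_singBot.2 ⟨T.comb.loser .top, ?_, rfl⟩, 1, ?_⟩
      · exact hd.trans_eq (T.comb.pos_loser .top).symm
      · rw [Function.iterate_one, h.toFun_left_loser_of_top hc ht]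
        · linarith
        · rw [totalLen]; linarith
        · rw [totalLen]; linarith
    · exact ⟨_, mem_singBot.2 ⟨α, pos_of_pos_move h.1 hα fun _ => e, rfl⟩, 0,
        h.1.left_move_flip .top _ e⟩
  · exact ⟨_, mem_singBot.2 ⟨α, pos_of_pos_move h.1 hα fun h => by simp [ArrowType.flip] at h, rfl⟩,
      0, CombData.left_move_same .bot _ _⟩

/-- Dually, the only new top endpoint is that of the loser of a bottom step, and `T` maps it to the
loser's old one. -/
lemma Valid.exists_mem_singTop (h : T.Valid) (hc : T.NoConnection) {v : ℝ}
    (hv : v ∈ T.step.singTop) : ∃ j, T.toFun^[j] v ∈ T.singTop := by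
  obtain ⟨α, hα, rfl⟩ := mem_singTop.1 hv
  rw [step_comb] at hα
  have hd := card_sub_one_pos A
  cases ht : T.stepType <;> rw [ht] at hα
  · refine ⟨0, mem_singTop.2 ⟨α, pos_of_pos_move h.1 hα fun h => by simp [ArrowType.flip] at h, ?_⟩⟩
    rw [step_comb, step_len, ht]
    exact CombData.left_move_same .top _ _
  · by_cases e : α = T.comb.loser .bot
    · subst e
      refine ⟨1, mem_singTop.2 ⟨T.comb.loser .bot, ?_, ?_⟩⟩
      · exact hd.trans_eq (T.comb.pos_loser .bot).symm
      · have e5 := h.2 (T.comb.loser .bot)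
        rw [Function.iterate_one, (h.toFun_toFun_of_bot hc ht le_rfl (by linarith)).1]
        ring
    · refine ⟨0, mem_singTop.2 ⟨α, pos_of_pos_move h.1 hα fun _ => e, ?_⟩⟩
      rw [step_comb, step_len, ht]
      exact h.1.left_move_flip .bot _ e

/-- A connection of the step, prolonged at both ends by pieces of `T`-orbits, would be a connection
of `T`. -/
lemma Valid.noConnection_step (h : T.Valid) (hc : T.NoConnection) : T.step.NoConnection := by
  intro u hu v hv m e
  have h' := h.step hc
  obtain ⟨u₀, hu₀, i, hi⟩ := h.exists_of_mem_singBot_step hc hu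
  obtain ⟨k, hk⟩ := h.exists_mem_singTop hc hv
  obtain ⟨α, -, hα⟩ := mem_singBot.1 hu
  have h1 := T.step.comb.left_nonneg .bot h'.nonneg α
  have h2 := T.step.comb.left_add_le_sum .bot h'.nonneg α
  have h3 := h'.2 α
  obtain ⟨j, hj⟩ := h.iterate_toFun_step hc m (x := u) (by rw [hα]; exact h1)
    (by rw [hα, totalLen]; linarith)
  rw [← e, hj, hi, ← Function.iterate_add_apply, ← Function.iterate_add_apply] at hk
  exact hc u₀ hu₀ _ hk _ rfl

lemma iter_succ (T : IEM A) (n : ℕ) : T.iter (n + 1) = (T.iter n).step :=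
  Function.iterate_succ_apply' _ _ _

lemma Valid.iter (h : T.Valid) (hc : T.NoConnection) (n : ℕ) :
    (T.iter n).Valid ∧ (T.iter n).NoConnection := by
  induction n with
  | zero => exact ⟨h, hc⟩
  | succ n ih =>
    rw [iter_succ]
    exact ⟨ih.1.step ih.2, ih.1.noConnection_step ih.2⟩

lemma iter_comb (T : IEM A) (n : ℕ) : (T.iter n).comb = T.rotationNumber.vertex n := by
  induction n with
  | zero => rfl
  | succ n ih => rw [iter_succ, step_comb, ih]; rfl

end IEM

/-! ### Every letter wins infinitely often. -/

open Filter

lemma exists_eventually_const_of_bounded {f : ℕ → ℕ} {N d : ℕ} (hf : ∀ n, N ≤ n → f n ≤ f (n + 1))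
    (hd : ∀ n, f n ≤ d) : ∀ᶠ n in atTop, f (n + 1) = f n := by
  have hb : BddAbove (f '' Set.Ici N) := ⟨d, by rintro _ ⟨n, -, rfl⟩; exact hd n⟩
  obtain ⟨M, hM, hMe⟩ := Nat.sSup_mem ⟨_, Set.mem_image_of_mem f (Set.mem_Ici.2 le_rfl)⟩ hb
  have hle : ∀ n, N ≤ n → f n ≤ f M := fun n hn => by
    rw [hMe]; exact le_csSup hb (Set.mem_image_of_mem f hn)
  have hge : ∀ n, M ≤ n → f M ≤ f n := fun n hn => by
    induction n, hn using Nat.le_induction with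
    | base => exact le_rfl
    | succ n hn ih => exact ih.trans (hf n (le_trans hM hn))
  filter_upwards [eventually_ge_atTop M] with n hn
  have hN : N ≤ n := le_trans hM hn
  exact le_antisymm ((hle _ (by omega)).trans (hge _ hn)) (hf n hN)

namespace CombData

lemma card_filter_pos_lt {A : Type*} [Fintype A] (π : CombData A) (r : ArrowType) {j : ℕ}
    (hj : j ≤ Fintype.card A) : (Finset.univ.filter fun β => π.pos r β < j).card = j := by
  rw [← Finset.card_image_of_injective _ (π.pos_injective r)]
  have : (Finset.univ.filter fun β => π.pos r β < j).image (π.pos r) = Finset.range j := by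
    ext i
    simp only [Finset.mem_image, Finset.mem_filter, Finset.mem_univ, true_and, Finset.mem_range]
    constructor
    · rintro ⟨β, h, rfl⟩; exact h
    · intro h
      obtain ⟨β, hβ⟩ := π.exists_pos_eq r (h.trans_le hj)
      exact ⟨β, hβ ▸ h, hβ⟩
  rw [this, Finset.card_range]

variable {A : Type*} [Fintype A] [Nontrivial A]

/-- The winner is last in the row which the move leaves unchanged. -/
lemma winner_eq_winner_or_loser_move (π : CombData A) (t t' : ArrowType) :
    π.winner t = (π.move t).winner t' ∨ π.winner t = (π.move t).loser t' := by
  cases t <;> cases t'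
  · exact Or.inl rfl
  · exact Or.inr rfl
  · exact Or.inr rfl
  · exact Or.inl rfl

end CombData

namespace IEM

variable {A : Type*} [Fintype A] [Nontrivial A] [DecidableEq A] {T : IEM A}

/-- The winner of the `n`-th step of the algorithm. -/
def winnerAt (T : IEM A) (n : ℕ) : A := (T.iter n).comb.winner (T.iter n).stepType

/-- The loser of the `n`-th step of the algorithm. -/
def loserAt (T : IEM A) (n : ℕ) : A := (T.iter n).comb.loser (T.iter n).stepType

/-- A letter that no longer wins keeps its length, and each of its losses shortens the total length
by that fixed amount. -/
lemma Valid.eventually_loserAt_ne (h : T.Valid) (hc : T.NoConnection) {α : A}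
    (hα : ∀ᶠ n in atTop, T.winnerAt n ≠ α) : ∀ᶠ n in atTop, T.loserAt n ≠ α := by
  obtain ⟨N, hN⟩ := eventually_atTop.1 hα
  by_contra hf
  rw [not_eventually] at hf
  have hlen : ∀ n, N ≤ n → (T.iter n).len α = (T.iter N).len α := fun n hn => by
    induction n, hn using Nat.le_induction with
    | base => rfl
    | succ n hn ih =>
      rw [iter_succ, step_len_apply, if_neg fun e => hN n hn e.symm, sub_zero, ih]
  have hpos := (h.iter hc N).1.2 α
  have hdec : ∀ n, (T.iter (n + 1)).totalLen ≤ (T.iter n).totalLen := fun n => by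
    have := (h.iter hc n).1.2 (T.loserAt n)
    rw [iter_succ, totalLen_step]
    rw [loserAt] at this
    linarith
  have hanti : Antitone fun n => (T.iter n).totalLen := antitone_nat_of_succ_le hdec
  have key : ∀ k : ℕ, ∃ n, N ≤ n ∧
      (T.iter n).totalLen ≤ (T.iter N).totalLen - k * (T.iter N).len α := fun k => by
    induction k with
    | zero => exact ⟨N, le_rfl, by simp⟩
    | succ k ih =>
      obtain ⟨n, hn, hk⟩ := ih
      obtain ⟨m, hm, hml⟩ := (frequently_atTop.1 hf) n
      rw [not_not] at hml
      refine ⟨m + 1, by omega, ?_⟩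
      have h1 := hanti hm
      have h2 := hlen m (hn.trans hm)
      rw [iter_succ, totalLen_step]
      rw [loserAt] at hml
      rw [hml, h2]
      push_cast
      simp only at h1
      linarith
  obtain ⟨k, hk⟩ := exists_nat_gt ((T.iter N).totalLen / (T.iter N).len α)
  rw [div_lt_iff₀ hpos] at hk
  obtain ⟨n, -, hn⟩ := key k
  have : 0 ≤ (T.iter n).totalLen := Finset.sum_nonneg fun β _ => (h.iter hc n).1.nonneg β
  linarith

/-- Every letter wins infinitely often. -/
theorem Valid.frequently_winnerAt (h : T.Valid) (hc : T.NoConnection) (α : A) :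
    ∃ᶠ n in atTop, T.winnerAt n = α := by
  classical
  -- The letters that win finitely often will be shown to form the same initial block of both rows,
  -- against irreducibility.
  set S : Finset A := Finset.univ.filter fun α => ∀ᶠ n in atTop, T.winnerAt n ≠ α with hS
  have hmem : ∀ α, α ∈ S ↔ ∀ᶠ n in atTop, T.winnerAt n ≠ α := by simp [hS]
  by_contra hα
  rw [not_frequently] at hα
  have hαS := (hmem α).2 hα
  have hirr : ∀ n, (T.iter n).comb.Irreducible := fun n => (h.iter hc n).1.1
  have hmove : ∀ n, (T.iter (n + 1)).comb = (T.iter n).comb.move (T.iter n).stepType :=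
    fun n => by rw [iter_succ, step_comb]
  have ev1 : ∀ᶠ n in atTop, ∀ β ∈ S, T.winnerAt n ≠ β ∧ T.loserAt n ≠ β := by
    rw [S.eventually_all]
    exact fun β hβ => ((hmem β).1 hβ).and (h.eventually_loserAt_ne hc ((hmem β).1 hβ))
  obtain ⟨N, hN⟩ := eventually_atTop.1 ev1
  have hrow : ∀ n r, r = (T.iter n).stepType ∨ r = (T.iter n).stepType.flip := fun n r => by
    cases r <;> cases (T.iter n).stepType <;> simp [ArrowType.flip]
  -- Once the letters of S neither win nor lose, a move can only push them to the right, so their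
  -- positions stabilise.
  have ev2 : ∀ᶠ n in atTop, ∀ β ∈ S, ∀ r,
      (T.iter (n + 1)).comb.pos r β = (T.iter n).comb.pos r β := by
    rw [S.eventually_all]
    intro β hβ
    have hr : ∀ r, ∀ᶠ n in atTop,
        (T.iter (n + 1)).comb.pos r β = (T.iter n).comb.pos r β := fun r => by
      refine exists_eventually_const_of_bounded (f := fun n => (T.iter n).comb.pos r β) (N := N)
        (d := Fintype.card A) (fun n hn => ?_) fun n => (CombData.pos_lt _ _ _).le
      have hl : β ≠ (T.iter n).comb.loser (T.iter n).stepType := (hN n hn β hβ).2.symm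
      simp only [hmove n]
      rcases hrow n r with e | e
      · rw [e, CombData.pos_move_same]
      · rw [e, (hirr n).pos_move_flip, if_neg hl]
        split_ifs <;> omega
    filter_upwards [hr .top, hr .bot] with n h1 h2 r
    cases r
    · exact h1
    · exact h2
  obtain ⟨M, hM⟩ := eventually_atTop.1 (ev1.and ev2)
  -- A letter of S to the right of the winner in the losing row would be shifted.
  have hle : ∀ n, M ≤ n → ∀ β ∈ S,
      (T.iter n).comb.pos (T.iter n).stepType.flip β ≤
        (T.iter n).comb.pos (T.iter n).stepType.flip (T.winnerAt n) := fun n hn β hβ => by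
    have hl : β ≠ (T.iter n).comb.loser (T.iter n).stepType := ((hM n hn).1 β hβ).2.symm
    have := (hM n hn).2 β hβ (T.iter n).stepType.flip
    rw [hmove, (hirr n).pos_move_flip, if_neg hl] at this
    rw [winnerAt]
    split_ifs at this <;> omega
  -- If δ preceded β it would do so forever, since moves act only beyond the winner and hence beyond
  -- β. But when δ wins, no letter of S is to its right in either row.
  have hlt : ∀ β ∈ S, ∀ δ ∉ S, ∀ r,
      (T.iter M).comb.pos r β < (T.iter M).comb.pos r δ := by
    intro β hβ δ hδ r
    by_contra hcon
    have hne : β ≠ δ := fun e => hδ (e ▸ hβ)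
    have h0 : (T.iter M).comb.pos r δ < (T.iter M).comb.pos r β :=
      lt_of_le_of_ne (not_lt.1 hcon) fun e => hne ((CombData.pos_inj _ _).1 e).symm
    have hall : ∀ n, M ≤ n → (T.iter n).comb.pos r δ < (T.iter n).comb.pos r β := fun n hn => by
      induction n, hn using Nat.le_induction with
      | base => exact h0
      | succ n hn ih =>
        rw [(hM n hn).2 β hβ r, hmove]
        rcases hrow n r with e | e
        · rwa [e, CombData.pos_move_same, ← e]
        · have := hle n hn β hβ
          rw [← e, winnerAt] at this
          rw [e, (hirr n).pos_move_flip, ← e, if_pos (by omega)]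
          exact ih
    rw [hmem, not_eventually] at hδ
    obtain ⟨n, hn, hw⟩ := (frequently_atTop.1 hδ) M
    rw [not_not] at hw
    have h1 := hall n hn
    rcases hrow n r with e | e
    · have := (T.iter n).comb.pos_le_winner (T.iter n).stepType β
      rw [← hw, winnerAt, e] at h1
      omega
    · have := hle n hn β hβ
      rw [hw, ← e] at this
      omega
  have hiff : ∀ r β, (T.iter M).comb.pos r β < S.card ↔ β ∈ S := fun r β => by
    have hb := (T.iter M).comb.pos_lt r β
    constructor
    · intro hlt'
      by_contra hβ
      have hsub : S ⊆ Finset.univ.filter fun δ =>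
          (T.iter M).comb.pos r δ < (T.iter M).comb.pos r β := fun δ hδ => by
        simpa using hlt δ hδ β hβ r
      have := Finset.card_le_card hsub
      rw [CombData.card_filter_pos_lt _ _ hb.le] at this
      omega
    · intro hβ
      have hsub : (Finset.univ.filter fun δ =>
          (T.iter M).comb.pos r δ < (T.iter M).comb.pos r β + 1) ⊆ S := fun δ hδ => by
        by_contra hδS
        have := hlt β hβ δ hδS r
        simp only [Finset.mem_filter, Finset.mem_univ, true_and] at hδ
        omega
      have := Finset.card_le_card hsub
      rw [CombData.card_filter_pos_lt _ _ hb] at this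
      omega
  refine CombData.not_irreducible_of_forall_iff .top (k := S.card) (Finset.card_pos.2 ⟨α, hαS⟩)
    ?_ (fun β => (hiff .top β).trans (hiff .bot β).symm) (hirr M)
  refine lt_of_lt_of_le (Finset.card_lt_card (Finset.ssubset_univ_iff.2 fun e => ?_))
    (Finset.card_univ (α := A)).le
  exact ((hM M le_rfl).1 (T.winnerAt M) (e ▸ Finset.mem_univ _)).1 rfl

end IEM

/-! ### Eventual positivity of the matrices B(m, n), and the lengths. -/

namespace RauzyPath

variable {A : Type*} [Fintype A] [Nontrivial A]

lemma vertex_irreducible {γ : RauzyPath A} (h : γ.start.Irreducible) (n : ℕ) : (γ.vertex n).Irreducible := by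
  induction n with
  | zero => exact h
  | succ n ih => exact ih.move _

variable [DecidableEq A] (γ : RauzyPath A)

@[simp] lemma B_self (m : ℕ) : γ.B m m = 1 := by
  cases m with
  | zero => rfl
  | succ m => simp [B]

lemma B_succ {m n : ℕ} (h : m ≤ n) :
    γ.B m (n + 1) = (γ.vertex n).arrowMatrix (γ.type n) * γ.B m n := by
  simp [B, h]

lemma B_mul {m k n : ℕ} (h1 : m ≤ k) (h2 : k ≤ n) : γ.B k n * γ.B m k = γ.B m n := by
  induction n, h2 using Nat.le_induction with
  | base => simp
  | succ n hn ih => rw [γ.B_succ hn, γ.B_succ (h1.trans hn), Matrix.mul_assoc, ih]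

/-- The winner of the arrow `γ_{n+1}`. -/
def winnerAt (n : ℕ) : A := (γ.vertex n).winner (γ.type n)

/-- The loser of the arrow `γ_{n+1}`. -/
def loserAt (n : ℕ) : A := (γ.vertex n).loser (γ.type n)

lemma B_succ_mulVec {m n : ℕ} (h : m ≤ n) (x : A → ℝ) (α : A) :
    (γ.B m (n + 1)).mulVec x α = (γ.B m n).mulVec x α +
      if α = γ.loserAt n then (γ.B m n).mulVec x (γ.winnerAt n) else 0 := by
  rw [γ.B_succ h, ← Matrix.mulVec_mulVec, CombData.arrowMatrix_mulVec]
  rfl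

lemma B_succ_apply {m n : ℕ} (h : m ≤ n) (α β : A) :
    γ.B m (n + 1) α β = γ.B m n α β +
      if α = γ.loserAt n then γ.B m n (γ.winnerAt n) β else 0 := by
  simpa using γ.B_succ_mulVec h (Pi.single β 1) α

lemma exists_nat_B (m n : ℕ) : ∃ N : Matrix A A ℕ, γ.B m n = N.map (↑) := by
  rcases le_or_gt m n with h | h
  · induction n, h using Nat.le_induction with
    | base => exact ⟨1, by simp⟩
    | succ n hn ih =>
      obtain ⟨N, hN⟩ := ih
      refine ⟨Matrix.of fun α β => N α β + if α = γ.loserAt n then N (γ.winnerAt n) β else 0, ?_⟩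
      ext α β
      rw [γ.B_succ_apply hn, hN]
      simp only [Matrix.map_apply, Matrix.of_apply]
      split_ifs <;> push_cast <;> rfl
  · refine ⟨1, ?_⟩
    cases n with
    | zero => simp [B]
    | succ n => rw [B, if_neg (by omega)]; simp

lemma B_nonneg (m n : ℕ) (α β : A) : 0 ≤ γ.B m n α β := by
  obtain ⟨N, hN⟩ := γ.exists_nat_B m n
  rw [hN]; simp

lemma one_le_B_of_pos {m n : ℕ} {α β : A} (h : 0 < γ.B m n α β) : 1 ≤ γ.B m n α β := by
  obtain ⟨N, hN⟩ := γ.exists_nat_B m n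
  rw [hN, Matrix.map_apply] at h ⊢
  have : 0 < N α β := by exact_mod_cast h
  exact_mod_cast this

lemma B_mulVec_nonneg {m n : ℕ} {x : A → ℝ} (hx : ∀ α, 0 ≤ x α) (α : A) :
    0 ≤ (γ.B m n).mulVec x α :=
  Finset.sum_nonneg fun β _ => mul_nonneg (γ.B_nonneg _ _ _ _) (hx β)

lemma le_B_mulVec {m n : ℕ} (h : m ≤ n) {x : A → ℝ} (hx : ∀ α, 0 ≤ x α) (α : A) :
    x α ≤ (γ.B m n).mulVec x α := by
  induction n, h using Nat.le_induction with
  | base => simp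
  | succ n hn ih =>
    rw [γ.B_succ_mulVec hn]
    have := γ.B_mulVec_nonneg (m := m) (n := n) hx (γ.winnerAt n)
    split_ifs <;> linarith

lemma B_apply_mono {m n n' : ℕ} (h : m ≤ n) (h' : n ≤ n') (α β : A) :
    γ.B m n α β ≤ γ.B m n' α β := by
  rw [← γ.B_mul h h']
  have := γ.le_B_mulVec h' (x := fun α => γ.B m n α β) (fun α => γ.B_nonneg _ _ _ _) α
  exact this

variable {γ}

/-- Let S be the set of rows where column β becomes positive. At late times a winner in S forces the
loser into S. Each winner is winner or loser of the next step, so once a letter outside S has won,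
no letter of S wins any more; yet β ∈ S wins infinitely often. -/
lemma exists_B_pos_apply (hw : ∀ α, ∃ᶠ n in atTop, γ.winnerAt n = α) (m : ℕ) (β α : A) :
    ∃ n, m ≤ n ∧ 0 < γ.B m n α β := by
  classical
  set S : Finset A := Finset.univ.filter fun α => ∃ n, m ≤ n ∧ 0 < γ.B m n α β with hS
  have hmem : ∀ α, α ∈ S ↔ ∃ n, m ≤ n ∧ 0 < γ.B m n α β := by simp [hS]
  rw [← hmem]
  by_contra hα
  have ev : ∀ᶠ n in atTop, ∀ δ ∈ S, 0 < γ.B m n δ β := by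
    rw [S.eventually_all]
    intro δ hδ
    obtain ⟨n, hn, hpos⟩ := (hmem δ).1 hδ
    filter_upwards [eventually_ge_atTop n] with n' hn'
    exact hpos.trans_le (γ.B_apply_mono hn hn' _ _)
  obtain ⟨N, hN⟩ := eventually_atTop.1 (ev.and (eventually_ge_atTop m))
  have hloser : ∀ n, N ≤ n → γ.winnerAt n ∈ S → γ.loserAt n ∈ S := fun n hn hwS => by
    have h1 := (hN n hn).1 _ hwS
    have hmn := (hN n hn).2
    refine (hmem _).2 ⟨n + 1, by omega, ?_⟩
    rw [γ.B_succ_apply hmn, if_pos rfl]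
    have := γ.B_nonneg m n (γ.loserAt n) β
    linarith
  have hβ : β ∈ S := (hmem β).2 ⟨m, le_rfl, by simp⟩
  obtain ⟨n₁, hn₁, h₁⟩ := (frequently_atTop.1 (hw α)) N
  have hall : ∀ n, n₁ ≤ n → γ.winnerAt n ∉ S := fun n hn => by
    induction n, hn using Nat.le_induction with
    | base => rwa [h₁]
    | succ n hn ih =>
      rcases (γ.vertex n).winner_eq_winner_or_loser_move (γ.type n) (γ.type (n + 1)) with e | e
      · rw [winnerAt, e] at ih; exact ih
      · rw [winnerAt, e] at ih
        exact fun hc => ih (hloser (n + 1) (by omega) hc)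
  obtain ⟨n₂, hn₂, h₂⟩ := (frequently_atTop.1 (hw β)) n₁
  exact hall n₂ hn₂ (h₂ ▸ hβ)

/-- If every letter wins infinitely often, then the matrices `B(m, n)` are eventually positive. -/
lemma exists_B_pos (hw : ∀ α, ∃ᶠ n in atTop, γ.winnerAt n = α) (m : ℕ) :
    ∃ n, m < n ∧ ∀ α β, 0 < γ.B m n α β := by
  have ev : ∀ᶠ n in atTop, ∀ α β, 0 < γ.B m n α β := by
    rw [eventually_all]
    intro α
    rw [eventually_all]
    intro β
    obtain ⟨n, hn, hpos⟩ := exists_B_pos_apply hw m β α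
    filter_upwards [eventually_ge_atTop n] with n' hn'
    exact hpos.trans_le (γ.B_apply_mono hn hn' _ _)
  obtain ⟨n, hn⟩ := (ev.and (eventually_gt_atTop m)).exists
  exact ⟨n, hn.2, hn.1⟩

lemma IsRotationNumberOf.frequently_winnerAt {T : IEM A} (h : γ.IsRotationNumberOf T) (α : A) :
    ∃ᶠ n in atTop, γ.winnerAt n = α := by
  obtain ⟨hv, hc, rfl⟩ := h
  refine (hv.frequently_winnerAt hc α).mono fun n hn => ?_
  rw [← hn, winnerAt, ← T.iter_comb]
  rfl

lemma IsRotationNumberOf.vertex_irreducible {T : IEM A} (h : γ.IsRotationNumberOf T) (n : ℕ) :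
    (γ.vertex n).Irreducible := by
  obtain ⟨hv, -, rfl⟩ := h
  exact RauzyPath.vertex_irreducible hv.1 n

/-- The lengths before the step are the image of the lengths after it under the transposed
matrix. -/
lemma IsRotationNumberOf.len_eq {T : IEM A} (h : γ.IsRotationNumberOf T) {m n : ℕ} (hmn : m ≤ n) :
    (T.iter m).len = (γ.B m n).transpose.mulVec (T.iter n).len := by
  have hirr := h.vertex_irreducible
  obtain ⟨-, -, rfl⟩ := h
  induction n, hmn using Nat.le_induction with
  | base => simp
  | succ n hn ih =>
    rw [ih]
    funext β
    simp only [Matrix.mulVec, dotProduct, Matrix.transpose_apply]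
    rw [← sub_eq_zero, ← Finset.sum_sub_distrib]
    have hw : T.rotationNumber.winnerAt n = (T.iter n).comb.winner (T.iter n).stepType := by
      rw [winnerAt, ← T.iter_comb]; rfl
    have hl : T.rotationNumber.loserAt n = (T.iter n).comb.loser (T.iter n).stepType := by
      rw [loserAt, ← T.iter_comb]; rfl
    have hne : ∀ α, T.rotationNumber.B m n α β * (T.iter n).len α -
        T.rotationNumber.B m (n + 1) α β * (T.iter (n + 1)).len α =
        (if α = T.rotationNumber.winnerAt n then T.rotationNumber.B m n α β *
          (T.iter n).len (T.rotationNumber.loserAt n) else 0) -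
        (if α = T.rotationNumber.loserAt n then
          T.rotationNumber.B m n (T.rotationNumber.winnerAt n) β *
          (T.iter (n + 1)).len α else 0) := fun α => by
      rw [B_succ_apply _ hn, IEM.iter_succ, IEM.step_len_apply, ← hw, ← hl]
      split_ifs <;> ring
    have hlen : (T.iter (n + 1)).len (T.rotationNumber.loserAt n) =
        (T.iter n).len (T.rotationNumber.loserAt n) := by
      rw [IEM.iter_succ, IEM.step_len_apply, if_neg, sub_zero]
      rw [← hw]
      exact ((hirr n).winner_ne_loser _).symm
    simp only [hne, Finset.sum_sub_distrib, Finset.sum_ite_eq', Finset.mem_univ, if_true, hlen,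
      sub_self]

end RauzyPath

/-! ### The cone: rational vertices and a uniform lower bound. -/

open Topology

namespace CombData

section

variable {A : Type*} [Fintype A]

instance : Finite (CombData A) :=
  Finite.of_injective (fun π : CombData A => (π.top, π.bot)) fun π π' h => by
    cases π; cases π'; simp_all

lemma mem_H {π : CombData A} {x : A → ℝ} : x ∈ π.H ↔ ∃ y, π.omega.mulVec y = x := Iff.rfl

lemma exists_int_omega (π : CombData A) (α β : A) : ∃ z : ℤ, π.omega α β = z := by
  rw [omega]
  split_ifs
  · exact ⟨1, by simp⟩
  · exact ⟨-1, by simp⟩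
  · exact ⟨0, by simp⟩

/-- The simplex slice of the closure of the cone `𝒞(π)`. -/
def slice (π : CombData A) : Set (A → ℝ) := {w | w ∈ π.H ∧ (∀ α, 0 ≤ w α) ∧ ∑ α, w α = 1}

lemma slice_eq (π : CombData A) : π.slice = (π.H : Set (A → ℝ)) ∩ stdSimplex ℝ A := rfl

lemma convex_slice (π : CombData A) : Convex ℝ π.slice := by
  rw [slice_eq]
  exact π.H.convex.inter (convex_stdSimplex ℝ A)

lemma isCompact_slice (π : CombData A) : IsCompact π.slice := by
  rw [slice_eq]
  exact (isCompact_stdSimplex ℝ A).inter_left π.H.closed_of_finiteDimensional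

/-- If w' ≠ w, the points w ± ε(w' - w) would both be in the slice for small ε, although w is
extreme. In particular an extreme point is determined by its zeros. -/
lemma eq_of_mem_extremePoints_slice {π : CombData A} {w w' : A → ℝ}
    (hw : w ∈ π.slice.extremePoints ℝ) (hH : w' ∈ π.H) (hs : ∑ α, w' α = 1)
    (h0 : ∀ α, w α = 0 → w' α = 0) : w' = w := by
  obtain ⟨⟨hwH, hwn, hws⟩, hext⟩ := hw
  have ev : ∀ᶠ ε : ℝ in 𝓝[>] 0, ∀ α, 0 ≤ w α + ε * (w' α - w α) ∧ 0 ≤ w α - ε * (w' α - w α) := by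
    rw [eventually_all]
    intro α
    rcases (hwn α).eq_or_lt with h | h
    · rw [← h, h0 α h.symm]; simp
    · have t1 : Tendsto (fun ε : ℝ => w α + ε * (w' α - w α)) (𝓝 0) (𝓝 (w α)) := by
        have : Continuous fun ε : ℝ => w α + ε * (w' α - w α) := by fun_prop
        simpa using this.tendsto 0
      have t2 : Tendsto (fun ε : ℝ => w α - ε * (w' α - w α)) (𝓝 0) (𝓝 (w α)) := by
        have : Continuous fun ε : ℝ => w α - ε * (w' α - w α) := by fun_prop
        simpa using this.tendsto 0
      refine nhdsWithin_le_nhds ?_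
      filter_upwards [t1.eventually (lt_mem_nhds h), t2.eventually (lt_mem_nhds h)] with ε a b
      exact ⟨a.le, b.le⟩
  obtain ⟨ε, hε, hε0⟩ := (ev.and self_mem_nhdsWithin).exists
  change 0 < ε at hε0
  have m1 : w + ε • (w' - w) ∈ π.slice := by
    refine ⟨π.H.add_mem hwH (π.H.smul_mem _ (π.H.sub_mem hH hwH)), fun α => (hε α).1, ?_⟩
    simp [Finset.sum_add_distrib, ← Finset.mul_sum, hs, hws]
  have m2 : w - ε • (w' - w) ∈ π.slice := by
    refine ⟨π.H.sub_mem hwH (π.H.smul_mem _ (π.H.sub_mem hH hwH)), fun α => (hε α).2, ?_⟩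
    simp [← Finset.mul_sum, hs, hws]
  have hseg : w ∈ openSegment ℝ (w + ε • (w' - w)) (w - ε • (w' - w)) :=
    ⟨1 / 2, 1 / 2, by norm_num, by norm_num, by norm_num, by module⟩
  have h1 := hext m1 m2 hseg
  have h2 : ε • (w' - w) = 0 := by simpa using h1
  rcases smul_eq_zero.1 h2 with h | h
  · exact absurd h hε0.ne'
  · exact sub_eq_zero.1 h

/-- A ℚ-linear retraction ℝ → ℚ, applied to each coordinate, preserves H(π) (Ω has integer entries),
the sum 1 and the zeros; so it fixes an extreme point. -/
lemma exists_rat_of_mem_extremePoints_slice {π : CombData A} {w : A → ℝ}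
    (hw : w ∈ π.slice.extremePoints ℝ) : ∃ q : A → ℚ, ∀ α, w α = q α := by
  obtain ⟨p, hp⟩ := LinearMap.exists_leftInverse_of_injective (Algebra.linearMap ℚ ℝ)
    (LinearMap.ker_eq_bot.2 Rat.cast_injective)
  have hp1 : p 1 = 1 := by simpa using LinearMap.congr_fun hp 1
  obtain ⟨⟨hH, -, hs⟩, -⟩ := id hw
  obtain ⟨y, rfl⟩ := mem_H.1 hH
  refine ⟨fun α => p (π.omega.mulVec y α), fun α => ?_⟩
  have := eq_of_mem_extremePoints_slice (w' := fun α => (p (π.omega.mulVec y α) : ℝ)) hw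
    ?_ ?_ ?_
  · exact (congrFun this α).symm
  · refine mem_H.2 ⟨fun α => (p (y α) : ℝ), ?_⟩
    funext α
    simp only [Matrix.mulVec, dotProduct, map_sum, Rat.cast_sum]
    refine Finset.sum_congr rfl fun β _ => ?_
    obtain ⟨z, hz⟩ := π.exists_int_omega α β
    rw [hz, ← zsmul_eq_mul, ← zsmul_eq_mul, map_zsmul]
    simp
  · rw [← Rat.cast_sum, ← map_sum, hs, hp1, Rat.cast_one]
  · intro α h
    simp [h]

lemma exists_common_denominator (π : CombData A) : ∃ N : ℕ, 0 < N ∧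
    ∀ w ∈ π.slice.extremePoints ℝ, ∀ α, ∃ z : ℤ, (N : ℝ) * w α = z := by
  classical
  have hfin : (π.slice.extremePoints ℝ).Finite := by
    refine Set.Finite.of_finite_image (f := fun w => Finset.univ.filter fun α => w α = 0)
      (Set.toFinite _) fun w hw w' hw' h => ?_
    refine (eq_of_mem_extremePoints_slice hw hw'.1.1 hw'.1.2.2 fun α hα => ?_).symm
    have := Finset.ext_iff.1 h α
    simp only [Finset.mem_filter, Finset.mem_univ, true_and] at this
    exact this.1 hα
  have hN : ∀ w ∈ π.slice.extremePoints ℝ, ∃ N : ℕ, 0 < N ∧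
      ∀ α, ∃ z : ℤ, (N : ℝ) * w α = z := fun w hw => by
    obtain ⟨q, hq⟩ := exists_rat_of_mem_extremePoints_slice hw
    refine ⟨∏ α, (q α).den, Finset.prod_pos fun α _ => (q α).den_pos, fun α => ?_⟩
    obtain ⟨k, hk⟩ := Finset.dvd_prod_of_mem (fun α => (q α).den) (Finset.mem_univ α)
    refine ⟨k * (q α).num, ?_⟩
    rw [hk, hq]
    have : ((q α).den : ℝ) * (q α : ℝ) = (q α).num := by exact_mod_cast Rat.den_mul_eq_num (q α)
    push_cast
    rw [← this]
    ring
  choose! N hNpos hN using hN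
  refine ⟨∏ w ∈ hfin.toFinset, N w,
    Finset.prod_pos fun w hw => hNpos w (hfin.mem_toFinset.1 hw), fun w hw α => ?_⟩
  obtain ⟨k, hk⟩ := Finset.dvd_prod_of_mem N (hfin.mem_toFinset.2 hw)
  obtain ⟨z, hz⟩ := hN w hw α
  refine ⟨k * z, ?_⟩
  rw [hk]
  push_cast
  rw [← hz]
  ring

/-- At a vertex of the slice, f·w is a positive multiple of 1/N for a common denominator N
independent of f. By Krein–Milman the bound 1/N extends to the whole slice, and by scaling to the
closed cone. -/
lemma exists_lower_bound (π : CombData A) : ∃ c : ℝ, 0 < c ∧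
    ∀ f : A → ℕ, (∀ w ∈ π.H, (∀ α, 0 ≤ w α) → w ≠ 0 → 0 < ∑ α, f α * w α) →
      ∀ w ∈ π.H, (∀ α, 0 ≤ w α) → c * ∑ α, w α ≤ ∑ α, f α * w α := by
  obtain ⟨N, hN, hden⟩ := π.exists_common_denominator
  have hN' : (0 : ℝ) < N := by exact_mod_cast hN
  refine ⟨(N : ℝ)⁻¹, inv_pos.2 hN', fun f hf w hw hw0 => ?_⟩
  have hext : π.slice.extremePoints ℝ ⊆ {w | (N : ℝ)⁻¹ ≤ ∑ α, f α * w α} := by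
    intro e he
    have h1 : 0 < ∑ α, f α * e α := by
      refine hf e he.1.1 he.1.2.1 fun h => ?_
      have := he.1.2.2
      simp [h] at this
    choose z hz using hden e he
    have h2 : (N : ℝ) * ∑ α, f α * e α = ((∑ α, f α * z α : ℤ) : ℝ) := by
      rw [Finset.mul_sum]
      push_cast
      refine Finset.sum_congr rfl fun α _ => ?_
      rw [← hz]
      ring
    have h3 : 0 < (N : ℝ) * ∑ α, f α * e α := by positivity
    rw [h2, Int.cast_pos] at h3
    have h4 : (1 : ℝ) ≤ N * ∑ α, f α * e α := by
      rw [h2]; exact_mod_cast h3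
    rw [Set.mem_ofPred_eq, inv_le_iff_one_le_mul₀ hN', mul_comm]
    exact h4
  have hsub : π.slice ⊆ {w | (N : ℝ)⁻¹ ≤ ∑ α, f α * w α} := by
    rw [← closure_convexHull_extremePoints π.isCompact_slice π.convex_slice]
    refine closure_minimal (convexHull_min hext ?_) ?_
    · refine convex_halfSpace_ge (f := fun w : A → ℝ => ∑ α, f α * w α) ?_ _
      constructor
      · intro x y
        simp [mul_add, Finset.sum_add_distrib]
      · intro r x
        simp only [Pi.smul_apply, smul_eq_mul, Finset.mul_sum]
        exact Finset.sum_congr rfl fun α _ => by ring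
    · exact isClosed_le continuous_const (by fun_prop)
  rcases (Finset.sum_nonneg fun α (_ : α ∈ Finset.univ) => hw0 α).eq_or_lt with h | h
  · rw [← h, mul_zero]
    exact Finset.sum_nonneg fun α _ => mul_nonneg (Nat.cast_nonneg _) (hw0 α)
  · have hm : (∑ α, w α)⁻¹ • w ∈ π.slice := by
      refine ⟨π.H.smul_mem _ hw, fun α => mul_nonneg (inv_nonneg.2 h.le) (hw0 α), ?_⟩
      simp only [Pi.smul_apply, smul_eq_mul, ← Finset.mul_sum]
      exact inv_mul_cancel₀ h.ne'
    have h1 := hsub hm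
    have h2 : ∑ α, f α * ((∑ α, w α)⁻¹ • w) α = (∑ α, w α)⁻¹ * ∑ α, f α * w α := by
      rw [Finset.mul_sum]
      exact Finset.sum_congr rfl fun α _ => by simp only [Pi.smul_apply, smul_eq_mul]; ring
    rw [Set.mem_ofPred_eq, h2, inv_mul_eq_div, le_div_iff₀ h] at h1
    exact h1

lemma exists_uniform_lower_bound (A : Type*) [Fintype A] : ∃ c : ℝ, 0 < c ∧
    ∀ (π : CombData A) (f : A → ℕ),
      (∀ w ∈ π.H, (∀ α, 0 ≤ w α) → w ≠ 0 → 0 < ∑ α, f α * w α) →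
      ∀ w ∈ π.H, (∀ α, 0 ≤ w α) → c * ∑ α, w α ≤ ∑ α, f α * w α := by
  choose c hc hb using exists_lower_bound (A := A)
  rcases isEmpty_or_nonempty (CombData A) with h | h
  · exact ⟨1, one_pos, fun π => h.elim π⟩
  · obtain ⟨π₀, hπ₀⟩ := Finite.exists_min c
    refine ⟨c π₀, hc π₀, fun π f hf w hw hw0 => (mul_le_mul_of_nonneg_right (hπ₀ π) ?_).trans
      (hb π f hf w hw hw0)⟩
    exact Finset.sum_nonneg fun α _ => hw0 α

lemma sum_filter_pos_eq_range (π : CombData A) (r : ArrowType) {k : ℕ}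
    (hk : k ≤ Fintype.card A) :
    ∑ β with π.pos r β < k, (π.pos r β : ℝ) = ∑ i ∈ Finset.range k, (i : ℝ) := by
  refine Finset.sum_nbij (π.pos r) (fun β hβ => ?_) ((π.pos_injective r).injOn) (fun i hi => ?_)
    fun _ _ => rfl
  · simpa using hβ
  · have hi' : i < k := by simpa using hi
    obtain ⟨β, hβ⟩ := π.exists_pos_eq r (hi'.trans_le hk)
    exact ⟨β, by simp [hβ, hi'], hβ⟩

/-- The first `k` letters of the row `r'` are, in the row `r`, at least as far to the right as the
first `k` places, and strictly farther in total unless they are the first `k` letters of `r`. -/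
lemma sum_filter_pos_sub (π : CombData A) (r r' : ArrowType) {k : ℕ} (hk : k ≤ Fintype.card A) :
    0 ≤ ∑ β with π.pos r' β < k, ((π.pos r β : ℝ) - π.pos r' β) ∧
    (∑ β with π.pos r' β < k, ((π.pos r β : ℝ) - π.pos r' β) = 0 →
      ∀ β, π.pos r' β < k ↔ π.pos r β < k) := by
  classical
  set S := Finset.univ.filter fun β => π.pos r' β < k with hS
  set S' := Finset.univ.filter fun β => π.pos r β < k with hS'
  have hc : S.card = k := π.card_filter_pos_lt r' hk
  have hc' : S'.card = k := π.card_filter_pos_lt r hk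
  have hcard : (S \ S').card = (S' \ S).card := by
    have h1 := Finset.card_sdiff_add_card_inter S S'
    have h2 := Finset.card_sdiff_add_card_inter S' S
    rw [Finset.inter_comm] at h2
    omega
  have e1 : ∑ β ∈ S, ((π.pos r β : ℝ) - π.pos r' β) =
      ∑ β ∈ S, (π.pos r β : ℝ) - ∑ β ∈ S', (π.pos r β : ℝ) := by
    rw [Finset.sum_sub_distrib]
    congr 1
    rw [hS, hS', sum_filter_pos_eq_range _ _ hk, sum_filter_pos_eq_range _ _ hk]
  have e2 : ∑ β ∈ S, ((π.pos r β : ℝ) - π.pos r' β) =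
      ∑ β ∈ S \ S', (π.pos r β : ℝ) - ∑ β ∈ S' \ S, (π.pos r β : ℝ) := by
    rw [e1, ← Finset.sum_sdiff_sub_sum_sdiff]
  have l1 : ((S \ S').card : ℝ) * k ≤ ∑ β ∈ S \ S', (π.pos r β : ℝ) := by
    rw [← nsmul_eq_mul]
    refine Finset.card_nsmul_le_sum _ _ _ fun β hβ => ?_
    simp only [hS, hS', Finset.mem_sdiff, Finset.mem_filter, Finset.mem_univ, true_and] at hβ
    exact_mod_cast not_lt.1 hβ.2
  have l2 : ∑ β ∈ S' \ S, (π.pos r β : ℝ) ≤ ((S' \ S).card : ℝ) * (k - 1) := by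
    rw [← nsmul_eq_mul]
    refine Finset.sum_le_card_nsmul _ _ _ fun β hβ => ?_
    simp only [hS, hS', Finset.mem_sdiff, Finset.mem_filter, Finset.mem_univ, true_and] at hβ
    have : π.pos r β + 1 ≤ k := hβ.1
    have : (π.pos r β : ℝ) + 1 ≤ k := by exact_mod_cast this
    linarith
  rw [← hcard] at l2
  -- In row `r` the letters of S \ S' have positions at least k, those of S' \ S at most k - 1, and
  -- the two sets have the same size.
  have h3 : ((S \ S').card : ℝ) ≤ ∑ β ∈ S, ((π.pos r β : ℝ) - π.pos r' β) := by
    rw [e2]; nlinarith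
  refine ⟨(Nat.cast_nonneg _).trans h3, fun h0 β => ?_⟩
  rw [h0] at h3
  have h4 : (S \ S').card = 0 := by
    have : ((S \ S').card : ℝ) = 0 := le_antisymm h3 (Nat.cast_nonneg _)
    exact_mod_cast this
  have h5 : S ⊆ S' := Finset.sdiff_eq_empty_iff_subset.1 (Finset.card_eq_zero.1 h4)
  have h6 : S' ⊆ S := Finset.sdiff_eq_empty_iff_subset.1 (Finset.card_eq_zero.1 (hcard ▸ h4))
  have := Finset.ext_iff.1 (Finset.Subset.antisymm h5 h6) β
  simpa [hS, hS'] using this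

/-- The witness is Ω applied to the difference of positions. Each coordinate is a sum of two
excesses from `sum_filter_pos_sub`; if both vanished, the letters before α in either row, or α alone
if it is first in both, would form a common initial block. -/
lemma Irreducible.cone_nonempty [Nontrivial A] {π : CombData A} (h : π.Irreducible) :
    π.cone.Nonempty := by
  have hd : 1 < Fintype.card A := Fintype.one_lt_card
  refine ⟨π.omega.mulVec fun α => (π.pos .top α : ℝ) - π.pos .bot α, mem_H.2 ⟨_, rfl⟩,
    fun α => ?_⟩
  rw [omega_mulVec_apply, left, left]
  have hb := π.sum_filter_pos_sub .top .bot (π.pos_lt .bot α).le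
  have ht := π.sum_filter_pos_sub .bot .top (π.pos_lt .top α).le
  have e : ∑ β with π.pos .top β < π.pos .top α, ((π.pos .top β : ℝ) - π.pos .bot β) =
      - ∑ β with π.pos .top β < π.pos .top α, ((π.pos .bot β : ℝ) - π.pos .top β) := by
    rw [← Finset.sum_neg_distrib]
    exact Finset.sum_congr rfl fun _ _ => by ring
  rw [e, sub_neg_eq_add]
  refine lt_of_le_of_ne (add_nonneg hb.1 ht.1) fun h0 => ?_
  have hb0 := hb.2 (by linarith [hb.1, ht.1])
  have ht0 := ht.2 (by linarith [hb.1, ht.1])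
  by_cases h1 : 1 ≤ π.pos .top α
  · exact not_irreducible_of_forall_iff .top h1 (π.pos_lt .top α) ht0 h
  by_cases h2 : 1 ≤ π.pos .bot α
  · exact not_irreducible_of_forall_iff .bot h2 (π.pos_lt .bot α) hb0 h
  · refine not_irreducible_of_forall_iff .top le_rfl hd (fun β => ?_) h
    have a1 : π.pos .top β = π.pos .top α ↔ β = α := π.pos_inj _
    have a2 : π.pos .bot β = π.pos .bot α ↔ β = α := π.pos_inj _
    have a3 : π.pos .top β = π.pos .top α ↔ π.pos .bot β = π.pos .bot α := a1.trans a2.symm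
    simp only [ArrowType.flip]
    omega

end

end CombData

/-! ### Contraction of the cones and existence of the accelerated times. -/

namespace RauzyPath

variable {A : Type*} [Fintype A] [Nontrivial A] [DecidableEq A] {γ : RauzyPath A}

lemma B_mulVec_mem_H (hirr : ∀ n, (γ.vertex n).Irreducible) {m n : ℕ} (h : m ≤ n) {x : A → ℝ}
    (hx : x ∈ (γ.vertex m).H) : (γ.B m n).mulVec x ∈ (γ.vertex n).H := by
  induction n, h using Nat.le_induction with
  | base => simpa using hx
  | succ n hn ih =>
    obtain ⟨y, hy⟩ := CombData.mem_H.1 ih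
    rw [γ.B_succ hn, ← Matrix.mulVec_mulVec, ← hy, ← (hirr n).omega_move]
    exact CombData.mem_H.2 ⟨_, rfl⟩

lemma contracts_of_pos (hirr : ∀ n, (γ.vertex n).Irreducible) {m n : ℕ} (h : m ≤ n)
    (hB : ∀ α β, 0 < γ.B m n α β) : γ.Contracts m n := by
  -- Since B x ≥ x coordinatewise, preimages of a convergent sequence stay bounded and have a
  -- convergent subsequence.
  have hcl : IsClosed {y | ∃ x ∈ (γ.vertex m).H, (∀ α, 0 ≤ x α) ∧ (γ.B m n).mulVec x = y} := by
    refine isClosed_of_closure_subset fun y hy => ?_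
    obtain ⟨u, hu, hlim⟩ := mem_closure_iff_seq_limit.1 hy
    choose x hxH hx0 hxu using hu
    have hb : ∃ R, ∀ k, x k ∈ Metric.closedBall (0 : A → ℝ) R := by
      obtain ⟨R, hR⟩ := (Metric.isBounded_range_of_tendsto u hlim).exists_norm_le
      refine ⟨R, fun k => ?_⟩
      rw [mem_closedBall_zero_iff]
      refine le_trans ?_ (hR (u k) ⟨k, rfl⟩)
      rw [pi_norm_le_iff_of_nonneg (norm_nonneg _)]
      intro α
      rw [Real.norm_of_nonneg (hx0 k α)]
      refine ((γ.le_B_mulVec h (hx0 k) α).trans (le_abs_self _)).trans ?_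
      rw [hxu k]
      exact norm_le_pi_norm (u k) α
    obtain ⟨R, hR⟩ := hb
    obtain ⟨a, -, φ, hφ, ha⟩ := (isCompact_closedBall (0 : A → ℝ) R).tendsto_subseq hR
    refine ⟨a, ?_, fun α => ?_, ?_⟩
    · exact (γ.vertex m).H.closed_of_finiteDimensional.mem_of_tendsto ha
        (Eventually.of_forall fun k => hxH _)
    · exact ge_of_tendsto' (tendsto_pi_nhds.1 ha α) fun k => hx0 _ α
    · have h1 : Tendsto (fun k => (γ.B m n).mulVec (x (φ k))) atTop
          (𝓝 ((γ.B m n).mulVec a)) := by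
        have : Continuous fun v : A → ℝ => (γ.B m n).mulVec v := by fun_prop
        exact (this.tendsto a).comp ha
      simp only [hxu] at h1
      exact tendsto_nhds_unique h1 (hlim.comp hφ.tendsto_atTop)
  refine (closure_minimal ?_ hcl).trans ?_
  · rintro _ ⟨x, hx, rfl⟩
    exact ⟨x, hx.1, fun α => (hx.2 α).le, rfl⟩
  · rintro _ ⟨x, hxH, hx0, rfl⟩
    by_cases hx : x = 0
    · right; simp [hx]
    · left
      refine ⟨B_mulVec_mem_H hirr h hxH, fun α => ?_⟩
      obtain ⟨β, hβ⟩ := Function.ne_iff.1 hx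
      exact Finset.sum_pos' (fun β _ => mul_nonneg (hB α β).le (hx0 β))
        ⟨β, Finset.mem_univ _, mul_pos (hB α β) (lt_of_le_of_ne (hx0 β) (Ne.symm hβ))⟩

/-- As 𝒞(π) is nonempty, its closure contains all nonnegative vectors of H(π). The value 0 is
excluded by B w ≥ w. -/
lemma Contracts.mulVec_pos {m n : ℕ} (hc : γ.Contracts m n) (h : m ≤ n)
    (hirr : (γ.vertex m).Irreducible) {w : A → ℝ} (hw : w ∈ (γ.vertex m).H)
    (hw0 : ∀ α, 0 ≤ w α) (hne : w ≠ 0) (α : A) : 0 < (γ.B m n).mulVec w α := by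
  obtain ⟨v, hvH, hv0⟩ := hirr.cone_nonempty
  have hmem : w ∈ closure (γ.vertex m).cone := by
    have ht : Tendsto (fun ε : ℝ => w + ε • v) (𝓝[>] 0) (𝓝 w) := by
      have : Continuous fun ε : ℝ => w + ε • v := by fun_prop
      simpa using (this.tendsto 0).mono_left nhdsWithin_le_nhds
    refine mem_closure_of_tendsto ht ?_
    filter_upwards [self_mem_nhdsWithin] with ε hε
    exact ⟨Submodule.add_mem _ hw (Submodule.smul_mem _ _ hvH),
      fun α => add_pos_of_nonneg_of_pos (hw0 α) (mul_pos hε (hv0 α))⟩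
  have hcont : Continuous fun v : A → ℝ => (γ.B m n).mulVec v := by fun_prop
  rcases hc (image_closure_subset_closure_image hcont (Set.mem_image_of_mem _ hmem)) with h1 | h1
  · exact h1.2 α
  · exfalso
    obtain ⟨β, hβ⟩ := Function.ne_iff.1 hne
    have h2 := γ.le_B_mulVec h hw0 β
    rw [Set.mem_singleton_iff.1 h1] at h2
    exact hβ (le_antisymm h2 (hw0 β))

/-- The infimum defining `accTime` is over a nonempty set, so it is attained and is not the default
value of `sInf`. -/
lemma IsRotationNumberOf.accTime_spec {T : IEM A} (hT : γ.IsRotationNumberOf T) (k : ℕ) :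
    γ.accTime k < γ.accTime (k + 1) ∧ γ.Contracts (γ.accTime k) (γ.accTime (k + 1)) := by
  obtain ⟨n, hn, hB⟩ := exists_B_pos hT.frequently_winnerAt (γ.accTime k)
  exact Nat.sInf_mem (s := {n | γ.accTime k < n ∧ γ.Contracts (γ.accTime k) n})
    ⟨n, hn, contracts_of_pos hT.vertex_irreducible hn.le hB⟩

lemma IsRotationNumberOf.strictMono_accTime {T : IEM A} (hT : γ.IsRotationNumberOf T) :
    StrictMono γ.accTime :=
  strictMono_nat_of_lt_succ fun k => (hT.accTime_spec k).1

end RauzyPath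

/-! ### Flows in a directed multigraph and the circulations they contain. -/

section Flow

variable {A V : Type*} [Fintype A]

/-- `p` is a flow of value one from `a` to `b` (a circulation if `a = b`) in the directed multigraph
with edges `e` from `L e` to `R e`. -/
def IsFlow (L R : A → V) (p : A → ℕ) (a b : V) : Prop :=
  ∀ φ : V → ℝ, ∑ e, (p e : ℝ) * (φ (R e) - φ (L e)) = φ b - φ a

variable {L R : A → V} {p q : A → ℕ} {a b c : V}

lemma IsFlow.add (hp : IsFlow L R p a b) (hq : IsFlow L R q b c) : IsFlow L R (p + q) a c := by
  intro φ
  simp only [Pi.add_apply, Nat.cast_add, add_mul, Finset.sum_add_distrib, hp φ, hq φ]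
  ring

lemma isFlow_zero (a : V) : IsFlow L R (0 : A → ℕ) a a := fun φ => by simp

lemma isFlow_single [DecidableEq A] (e : A) : IsFlow L R (Pi.single e 1) (L e) (R e) := by
  intro φ
  rw [Finset.sum_eq_single e]
  · simp
  · intro f _ hf; simp [hf]
  · simp

lemma IsFlow.of_add_single [DecidableEq A] {e : A} (h : IsFlow L R (p + Pi.single e 1) (L e) b) :
    IsFlow L R p (R e) b := by
  intro φ
  have h1 := h φ
  simp only [Pi.add_apply, Nat.cast_add, add_mul, Finset.sum_add_distrib,
    isFlow_single (L := L) (R := R) e φ] at h1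
  linarith

lemma IsFlow.exists_edge (h : IsFlow L R p a b) (hab : a ≠ b) : ∃ e, p e ≠ 0 ∧ L e = a := by
  classical
  by_contra hn
  push Not at hn
  -- Tested against the indicator of a, the flow gives -1, whereas without edges leaving a all terms
  -- would be nonnegative.
  have h1 := h (Pi.single a 1)
  rw [Pi.single_eq_same, Pi.single_eq_of_ne hab.symm] at h1
  have h2 : 0 ≤ ∑ e, (p e : ℝ) * ((Pi.single a 1 : V → ℝ) (R e) -
      (Pi.single a 1 : V → ℝ) (L e)) := by
    refine Finset.sum_nonneg fun e _ => ?_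
    by_cases he : p e = 0
    · simp [he]
    · rw [Pi.single_eq_of_ne (hn e he), sub_zero]
      refine mul_nonneg (Nat.cast_nonneg _) ?_
      rw [Pi.single_apply]
      split_ifs <;> norm_num
  linarith

/-- A walk is extracted from the flow: q is the part already travelled, F the set of visited
vertices, p what remains from the current vertex v. Returning to F closes a circulation; if v = b,
the nonzero rest p is one. Otherwise F, with one element more than q has edges, would outgrow V by
the time p is exhausted. -/
lemma exists_circulation_aux [Fintype V] [DecidableEq V] [DecidableEq A] (N : ℕ) :
    ∀ (p q : A → ℕ) (v : V) (F : Finset V), ∑ e, p e = N → IsFlow L R p v b →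
      (∀ u ∈ F, ∃ q' ≤ q, IsFlow L R q' u v) → ∑ e, q e + 1 = F.card →
      Fintype.card V ≤ ∑ e, p e + ∑ e, q e → ∃ c ≤ p + q, c ≠ 0 ∧ IsFlow L R c b b := by
  induction N with
  | zero =>
    intro p q v F hN _ _ hF hV
    have := F.card_le_univ
    omega
  | succ N ih =>
    intro p q v F hN hp hq hF hV
    by_cases hvb : v = b
    · subst hvb
      refine ⟨p, le_self_add, fun h => ?_, hp⟩
      simp [h] at hN
    · obtain ⟨e, he, rfl⟩ := hp.exists_edge hvb
      obtain ⟨p', rfl⟩ : ∃ p', p = p' + Pi.single e 1 := by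
        refine ⟨p - Pi.single e 1, (tsub_add_cancel_of_le ?_).symm⟩
        intro f
        by_cases hf : f = e
        · subst hf; simp; omega
        · simp [hf]
      have hs : ∑ f, (Pi.single e 1 : A → ℕ) f = 1 := by simp
      have hp' := hp.of_add_single
      by_cases hu : R e ∈ F
      · obtain ⟨q', hq', hfl⟩ := hq _ hu
        refine ⟨q' + Pi.single e 1, ?_, fun h => ?_, fun φ => ?_⟩
        · rw [add_comm p', add_assoc, add_comm]
          exact add_le_add_right (hq'.trans le_add_self) _
        · have := congrFun h e
          simp at this
        · rw [hfl.add (isFlow_single e) φ, sub_self, sub_self]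
      · simp only [Pi.add_apply, Finset.sum_add_distrib, hs] at hN hV
        have h1 : ∀ u ∈ insert (R e) F, ∃ q' ≤ q + Pi.single e 1, IsFlow L R q' u (R e) := by
          intro u hu'
          rcases Finset.mem_insert.1 hu' with rfl | hu'
          · exact ⟨0, zero_le, isFlow_zero _⟩
          · obtain ⟨q', hq', hfl⟩ := hq u hu'
            exact ⟨q' + Pi.single e 1, add_le_add_left hq' _, hfl.add (isFlow_single e)⟩
        have h2 : ∑ f, (q + Pi.single e 1 : A → ℕ) f + 1 = (insert (R e) F).card := by
          rw [Finset.card_insert_of_notMem hu]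
          simp only [Pi.add_apply, Finset.sum_add_distrib, hs]
          omega
        have h3 : Fintype.card V ≤ ∑ f, p' f + ∑ f, (q + Pi.single e 1 : A → ℕ) f := by
          simp only [Pi.add_apply, Finset.sum_add_distrib, hs]
          omega
        obtain ⟨c, hc, hc0, hcf⟩ := ih p' _ (R e) _ (by omega) hp' h1 h2 h3
        exact ⟨c, hc.trans_eq (by rw [add_comm q, add_assoc]), hc0, hcf⟩

/-- A flow of value one of size at least the number of vertices contains a nonzero circulation. -/
lemma IsFlow.exists_circulation [Finite V] (hp : IsFlow L R p a b)
    (hV : Nat.card V ≤ ∑ e, p e) : ∃ c ≤ p, c ≠ 0 ∧ IsFlow L R c b b := by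
  classical
  have := Fintype.ofFinite V
  rw [Nat.card_eq_fintype_card] at hV
  simpa using exists_circulation_aux (L := L) (R := R) _ p 0 a {a} rfl hp
    (fun u hu => ⟨0, le_rfl, by rw [Finset.mem_singleton.1 hu]; exact isFlow_zero _⟩) (by simp)
    (by simpa using hV)

end Flow

/-! ### Marked points, ker Ω, and columns of B(m, n) as flows. -/

namespace CombData

section

variable {A : Type*} [Fintype A] (π : CombData A)

lemma omega_transpose : π.omega.transpose = -π.omega := by
  ext α β
  simp only [Matrix.transpose_apply, Matrix.neg_apply, omega]
  by_cases h1 : π.top β < π.top α ∧ π.bot α < π.bot β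
  · rw [if_pos h1, if_neg fun h => h.1.asymm h1.1, if_pos h1]
    norm_num
  · by_cases h2 : π.top α < π.top β ∧ π.bot β < π.bot α
    · simp [h2, h1]
    · simp [h1, h2]

variable {π}

/-- Since Ω is antisymmetric, its image is the orthogonal complement of its kernel. -/
lemma mem_H_of_forall_dotProduct {x : A → ℝ}
    (h : ∀ k, π.omega.mulVec k = 0 → k ⬝ᵥ x = 0) : x ∈ π.H := by
  classical
  by_contra hx
  obtain ⟨f, hf, hf0⟩ := Submodule.exists_dual_map_eq_bot_of_notMem hx inferInstance
  set k : A → ℝ := fun α => f (Pi.single α 1) with hk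
  have hfk : ∀ y, f y = k ⬝ᵥ y := fun y => by
    conv_lhs => rw [pi_eq_sum_univ' y]
    simp only [map_sum, map_smul, smul_eq_mul, dotProduct, hk]
    exact Finset.sum_congr rfl fun α _ => by rw [mul_comm]
  refine hf ((hfk x).trans (h k ?_))
  have h1 : π.omega.transpose.mulVec k = 0 := by
    rw [Matrix.mulVec_transpose]
    refine dotProduct_eq_zero _ fun y => ?_
    rw [← Matrix.dotProduct_mulVec, ← hfk]
    have : f (π.omega.mulVec y) ∈ π.H.map f := Submodule.mem_map_of_mem (mem_H.2 ⟨y, rfl⟩)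
    rw [hf0] at this
    exact (Submodule.mem_bot ℝ).1 this
  rw [omega_transpose, Matrix.neg_mulVec] at h1
  exact neg_eq_zero.1 h1

instance (π : CombData A) : Finite π.MarkedPoint := Quot.finite _

/-- The left end point of the side labelled `α`. -/
def leftPoint (π : CombData A) (α : A) : π.MarkedPoint := Quot.mk _ (Sum.inl (π.top α).castSucc)

/-- The right end point of the side labelled `α`. -/
def rightPoint (π : CombData A) (α : A) : π.MarkedPoint := Quot.mk _ (Sum.inl (π.top α).succ)

lemma leftPoint_eq (π : CombData A) (α : A) :
    π.leftPoint α = Quot.mk _ (Sum.inr (π.bot α).castSucc) := Quot.sound (.left α)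

lemma rightPoint_eq (π : CombData A) (α : A) :
    π.rightPoint α = Quot.mk _ (Sum.inr (π.bot α).succ) := Quot.sound (.right α)

end

variable {A V : Type*} [Fintype A] [Nontrivial A]

/-- `L α` and `R α` are the end points of the side labelled `α` of the suspension polygon, in a set
`V` of marked points. -/
structure IsMarking (π : CombData A) (L R : A → V) : Prop where
  succ : ∀ r α β, π.pos r β = π.pos r α + 1 → L β = R α
  finish : ∀ t, R (π.winner t) = R (π.loser t)
  ker : ∀ k, π.omega.mulVec k = 0 → ∃ φ : V → ℝ, ∀ α, k α = φ (R α) - φ (L α)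

lemma isMarking (π : CombData A) : π.IsMarking π.leftPoint π.rightPoint where
  succ r α β h := by
    cases r
    · have : (π.top β).castSucc = (π.top α).succ := Fin.ext h
      rw [leftPoint, rightPoint, this]
    · have : (π.bot β).castSucc = (π.bot α).succ := Fin.ext h
      rw [leftPoint_eq, rightPoint_eq, this]
  finish := by
    have hd := Fintype.card_pos (α := A)
    have h1 : (π.top (π.winner .top)).succ = Fin.last _ := Fin.ext (by
      have := π.pos_winner .top
      simp only [pos] at this
      rw [Fin.val_succ, this, Fin.val_last]; omega)
    have h2 : (π.bot (π.winner .bot)).succ = Fin.last _ := Fin.ext (by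
      have := π.pos_winner .bot
      simp only [pos] at this
      rw [Fin.val_succ, this, Fin.val_last]; omega)
    have h : π.rightPoint (π.winner .top) = π.rightPoint (π.winner .bot) := by
      rw [rightPoint_eq π (π.winner .bot), rightPoint, h1, h2]
      exact Quot.sound .finish
    intro t
    rw [loser_eq_winner_flip]
    cases t
    · exact h
    · exact h.symm
  ker k hk := by
    have hk' : ∀ α, π.left .bot k α = π.left .top k α := fun α => by
      have := congrFun hk α
      rw [omega_mulVec_apply] at this
      exact sub_eq_zero.1 this
    -- The potential is the partial sum of k along each line; Ω k = 0 says that it respects the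
    -- gluing.
    refine ⟨Quot.lift (Sum.elim (fun i => ∑ β with π.pos .top β < i, k β)
      (fun i => ∑ β with π.pos .bot β < i, k β)) ?_, fun α => ?_⟩
    · intro x y h
      cases h with
      | start => simp
      | finish =>
        simp only [Sum.elim_inl, Sum.elim_inr, Fin.val_last, pos_lt]
      | left α => exact (hk' α).symm
      | right α =>
        have h1 := π.left_add_eq .top k α
        have h2 := π.left_add_eq .bot k α
        simp only [Sum.elim_inl, Sum.elim_inr, Fin.val_succ, Nat.lt_succ_iff]
        exact h1.symm.trans (((congrArg (· + k α) (hk' α)).symm).trans h2)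
    · have h1 := π.left_add_eq .top k α
      simp only [leftPoint, rightPoint, Sum.elim_inl, Fin.val_succ, Nat.lt_succ_iff]
      exact eq_sub_of_add_eq ((add_comm _ _).trans h1)

variable {π : CombData A} {L R : A → V}

lemma IsMarking.mem_H (h : π.IsMarking L R) {c : A → ℕ} {b : V} (hc : IsFlow L R c b b) :
    (fun e => (c e : ℝ)) ∈ π.H := by
  refine mem_H_of_forall_dotProduct fun k hk => ?_
  obtain ⟨φ, hφ⟩ := h.ker k hk
  have := hc φ
  rw [sub_self] at this
  rw [← this]
  exact Finset.sum_congr rfl fun e _ => by rw [hφ, mul_comm]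

variable [DecidableEq A]

/-- In the losing row the loser is inserted just after the winner, so the shortened winner ends
where the loser begins. The set V is kept, so all polygons of the path are marked by the same
points. -/
lemma IsMarking.move (h : π.IsMarking L R) (hirr : π.Irreducible) (t : ArrowType) :
    (π.move t).IsMarking L (Function.update R (π.winner t) (L (π.loser t))) where
  succ r α β e := by
    have hlt := hirr.pos_winner_lt_loser t
    by_cases hr : r = t
    · subst hr
      rw [pos_move_same, pos_move_same] at e
      have hα : α ≠ π.winner r := fun hα => by
        have := π.pos_le_winner r β
        rw [hα] at e
        omega
      rw [Function.update_of_ne hα]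
      exact h.succ _ _ _ e
    · have hr' : r = t.flip := by cases r <;> cases t <;> simp_all [ArrowType.flip]
      subst hr'
      rw [hirr.pos_move_flip, hirr.pos_move_flip] at e
      by_cases hα : α = π.winner t
      · subst hα
        rw [Function.update_self]
        rw [if_pos le_rfl] at e
        split_ifs at e with h1 h2
        · omega
        · rw [h2]
        · omega
      · rw [Function.update_of_ne hα]
        have hα' : π.pos t.flip α ≠ π.pos t.flip (π.winner t) := fun c => hα ((π.pos_inj _).1 c)
        by_cases hl : α = π.loser t
        · subst hl
          rw [if_neg hlt.not_ge, if_pos rfl] at e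
          -- The letter after the loser used to follow the winner, whose old right end point is that
          -- of the loser.
          rw [← h.finish]
          refine h.succ t.flip _ _ ?_
          split_ifs at e <;> omega
        · rw [if_neg hl] at e
          refine h.succ t.flip _ _ ?_
          split_ifs at e <;> omega
  finish := by
    have hlt := hirr.pos_winner_lt_loser t
    -- The new last letter of the losing row is the former neighbour of the loser, or the loser
    -- itself if it already stood just after the winner.
    have hw : ∀ y, (π.move t).pos t.flip y = Fintype.card A - 1 →
        Function.update R (π.winner t) (L (π.loser t)) y = L (π.loser t) := by
      intro y hy
      rw [hirr.pos_move_flip] at hy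
      have hl := π.pos_loser t
      by_cases hyw : y = π.winner t
      · rw [hyw, Function.update_self]
      rw [Function.update_of_ne hyw]
      split_ifs at hy with h1 h2
      · omega
      · rw [h2, ← h.finish]
        exact (h.succ t.flip _ _ (by omega)).symm
      · exact (h.succ t.flip _ _ (by omega)).symm
    have h1 := hw _ (pos_winner (π.move t) t.flip)
    have h2 : (π.move t).winner t = π.winner t := by
      rw [← (π.move t).pos_inj t, pos_winner, pos_move_same, pos_winner]
    have h3 : Function.update R (π.winner t) (L (π.loser t)) ((π.move t).winner t) =
        Function.update R (π.winner t) (L (π.loser t)) ((π.move t).winner t.flip) := by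
      rw [h1, h2, Function.update_self]
    intro t'
    rw [loser_eq_winner_flip]
    cases t <;> cases t'
    · exact h3
    · exact h3.symm
    · exact h3.symm
    · exact h3
  ker k' hk' := by
    have hne := hirr.winner_ne_loser t
    -- This is k = ᵗB k', so `omega_move` gives B Ω k = 0 and hence Ω k = 0.
    set k := Function.update k' (π.winner t) (k' (π.winner t) + k' (π.loser t)) with hkdef
    have hkw : k (π.winner t) = k' (π.winner t) + k' (π.loser t) := by simp [hkdef]
    have hko : ∀ α, α ≠ π.winner t → k α = k' α := fun α hα => by simp [hkdef, hα]
    have hst : π.stepLen t k = k' := by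
      funext α
      rw [stepLen_eq, hko _ hne.symm]
      split_ifs with c
      · rw [c, hkw]; ring
      · rw [hko α c, sub_zero]
    rw [← hst, hirr.omega_move] at hk'
    have hk : π.omega.mulVec k = 0 := by
      have ha : ∀ α, α ≠ π.loser t → π.omega.mulVec k α = 0 := fun α hα => by
        have := congrFun hk' α
        rwa [arrowMatrix_mulVec, if_neg hα, add_zero] at this
      funext α
      by_cases hα : α = π.loser t
      · have := congrFun hk' α
        rwa [arrowMatrix_mulVec, ha _ hne, ite_self, add_zero] at this
      · exact ha α hα
    obtain ⟨φ, hφ⟩ := h.ker k hk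
    refine ⟨φ, fun α => ?_⟩
    by_cases hα : α = π.winner t
    · subst hα
      have h1 := hφ (π.winner t)
      have h2 := hφ (π.loser t)
      rw [hkw] at h1
      rw [hko _ hne.symm] at h2
      rw [Function.update_self]
      rw [h.finish] at h1
      linarith
    · rw [Function.update_of_ne hα, ← hko α hα]
      exact hφ α

/-- The winner's old side has the same boundary as its new side followed by the loser's side; so x
and B x have the same boundary. -/
lemma IsMarking.sum_move (h : π.IsMarking L R) (hirr : π.Irreducible) (t : ArrowType) (x : A → ℝ)
    (φ : V → ℝ) : ∑ β, (π.arrowMatrix t).mulVec x β *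
      (φ (Function.update R (π.winner t) (L (π.loser t)) β) - φ (L β)) =
      ∑ β, x β * (φ (R β) - φ (L β)) := by
  have hne := hirr.winner_ne_loser t
  have key : ∀ β, (π.arrowMatrix t).mulVec x β *
      (φ (Function.update R (π.winner t) (L (π.loser t)) β) - φ (L β)) =
      x β * (φ (R β) - φ (L β)) +
      (if β = π.loser t then x (π.winner t) * (φ (R β) - φ (L β)) else 0) +
      (if β = π.winner t then x β * (φ (L (π.loser t)) - φ (R β)) else 0) := fun β => by
    rw [arrowMatrix_mulVec, Function.update_apply]
    by_cases h1 : β = π.winner t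
    · have h2 : β ≠ π.loser t := h1 ▸ hne
      simp only [h1, hne, if_true, if_false]
      ring
    · by_cases h2 : β = π.loser t
      · simp only [h2, hne.symm, if_true, if_false]
        ring
      · simp only [h1, h2, if_false]
        ring
  simp only [key, Finset.sum_add_distrib, Finset.sum_ite_eq', Finset.mem_univ, if_true, h.finish]
  ring

end CombData

namespace RauzyPath

variable {A : Type*} [Fintype A] [Nontrivial A] [DecidableEq A] (γ : RauzyPath A)

/-- The right end points of the sides of the `n`-th suspension polygon, in the set of marked points
of the first one. -/
def rightPoint : ℕ → A → γ.start.MarkedPoint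
  | 0 => γ.start.rightPoint
  | n + 1 => Function.update (rightPoint n) (γ.winnerAt n) (γ.start.leftPoint (γ.loserAt n))

variable {γ}

lemma isMarking (hirr : ∀ n, (γ.vertex n).Irreducible) (n : ℕ) :
    (γ.vertex n).IsMarking γ.start.leftPoint (γ.rightPoint n) := by
  induction n with
  | zero => exact γ.start.isMarking
  | succ n ih => exact ih.move (hirr n) _

lemma sum_B_mulVec (hirr : ∀ n, (γ.vertex n).Irreducible) {m n : ℕ} (h : m ≤ n) (x : A → ℝ)
    (φ : γ.start.MarkedPoint → ℝ) :
    ∑ β, (γ.B m n).mulVec x β * (φ (γ.rightPoint n β) - φ (γ.start.leftPoint β)) =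
      ∑ β, x β * (φ (γ.rightPoint m β) - φ (γ.start.leftPoint β)) := by
  induction n, h using Nat.le_induction with
  | base => simp
  | succ n hn ih =>
    rw [← ih, γ.B_succ hn, ← Matrix.mulVec_mulVec]
    exact (isMarking hirr n).sum_move (hirr n) _ _ _

/-- If a column of `B(m, n)` has a sum which is at least the number of marked points, then this column
becomes positive at any later time `n'` such that `B(n, n')` contracts. -/
lemma Contracts.one_le_B (hirr : ∀ n, (γ.vertex n).Irreducible) {m n n' : ℕ} (hmn : m ≤ n)
    (hnn' : n ≤ n') (hc : γ.Contracts n n') {α : A}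
    (hs : (γ.start.numMarkedPoints : ℝ) ≤ ∑ β, γ.B m n β α) (β : A) : 1 ≤ γ.B m n' β α := by
  obtain ⟨N, hN⟩ := γ.exists_nat_B m n
  have hcol : (γ.B m n).mulVec (Pi.single α 1) = fun e => (N e α : ℝ) := by
    funext e; simp [hN]
  have hflow : IsFlow γ.start.leftPoint (γ.rightPoint n) (fun e => N e α)
      (γ.start.leftPoint α) (γ.rightPoint m α) := by
    intro φ
    have h1 := sum_B_mulVec hirr hmn (Pi.single α 1) φ
    rw [hcol] at h1
    rw [h1, Finset.sum_eq_single α]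
    · simp
    · intro e _ he; simp [he]
    · simp
  obtain ⟨c, hcN, hc0, hcf⟩ := hflow.exists_circulation (by
    simp only [hN, Matrix.map_apply] at hs
    exact_mod_cast hs)
  have hpos := hc.mulVec_pos hnn' (hirr n) ((isMarking hirr n).mem_H hcf)
    (fun e => Nat.cast_nonneg _) (fun h => hc0 (funext fun e => by
      have := congrFun h e
      simpa using this)) β
  refine γ.one_le_B_of_pos (hpos.trans_le ?_)
  rw [← γ.B_mul hmn hnn', Matrix.mul_apply]
  refine Finset.sum_le_sum fun e _ => mul_le_mul_of_nonneg_left ?_ (γ.B_nonneg _ _ _ _)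
  rw [hN, Matrix.map_apply]
  exact Nat.cast_le.2 (hcN e)

end RauzyPath

/-! ### Norms, growth under condition (a'), and the estimates. -/

namespace RauzyPath

variable {A : Type*} [Fintype A] [Nontrivial A] [DecidableEq A] (γ : RauzyPath A)

lemma sum_B_le_matNorm (m n : ℕ) (α : A) : ∑ β, γ.B m n α β ≤ matNorm (γ.B m n) := by
  have h := le_ciSup (f := fun α => ∑ β, |γ.B m n α β|) (Set.finite_range _).bddAbove α
  simp only [abs_of_nonneg (γ.B_nonneg m n _ _)] at h
  simpa only [matNorm, abs_of_nonneg (γ.B_nonneg m n _ _)] using h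

lemma matNorm_B_le {m n : ℕ} {c : ℝ} (h : ∀ α, ∑ β, γ.B m n α β ≤ c) : matNorm (γ.B m n) ≤ c := by
  refine ciSup_le fun α => ?_
  simpa only [abs_of_nonneg (γ.B_nonneg m n _ _)] using h α

lemma sum_B_mono {m n n' : ℕ} (h : m ≤ n) (h' : n ≤ n') (α : A) :
    ∑ β, γ.B m n α β ≤ ∑ β, γ.B m n' α β :=
  Finset.sum_le_sum fun β _ => γ.B_apply_mono h h' α β

lemma one_le_sum_B {m n : ℕ} (h : m ≤ n) (α : A) : 1 ≤ ∑ β, γ.B m n α β := by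
  have := γ.sum_B_mono le_rfl h α
  simpa [Matrix.one_apply] using this

lemma one_le_matNorm_B {m n : ℕ} (h : m ≤ n) : 1 ≤ matNorm (γ.B m n) :=
  (γ.one_le_sum_B h (Classical.arbitrary A)).trans (γ.sum_B_le_matNorm m n _)

lemma matNorm_B_mono {m n n' : ℕ} (h : m ≤ n) (h' : n ≤ n') :
    matNorm (γ.B m n) ≤ matNorm (γ.B m n') :=
  γ.matNorm_B_le fun α => (γ.sum_B_mono h h' α).trans (γ.sum_B_le_matNorm m n' α)

lemma matNorm_B_mul_le {m k n : ℕ} (h1 : m ≤ k) (h2 : k ≤ n) :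
    matNorm (γ.B m n) ≤ matNorm (γ.B k n) * matNorm (γ.B m k) := by
  refine γ.matNorm_B_le fun α => ?_
  simp only [← γ.B_mul h1 h2, Matrix.mul_apply]
  rw [Finset.sum_comm]
  simp only [← Finset.mul_sum]
  calc ∑ δ, γ.B k n α δ * ∑ β, γ.B m k δ β
      ≤ ∑ δ, γ.B k n α δ * matNorm (γ.B m k) := Finset.sum_le_sum fun δ _ =>
        mul_le_mul_of_nonneg_left (γ.sum_B_le_matNorm m k δ) (γ.B_nonneg _ _ _ _)
    _ = (∑ δ, γ.B k n α δ) * matNorm (γ.B m k) := (Finset.sum_mul _ _ _).symm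
    _ ≤ _ := mul_le_mul_of_nonneg_right (γ.sum_B_le_matNorm k n α)
        (zero_le_one.trans (γ.one_le_matNorm_B h1))

variable {γ}

/-- Under condition (a'), the norms of `B(0, n_k)` grow subexponentially in the sense that two
accelerated steps multiply the exponent by a factor which is arbitrarily close to one. -/
lemma ConditionA'.exists_matNorm_le (ha : γ.ConditionA') (hmono : StrictMono γ.accTime) {τ : ℝ}
    (hτ : 0 < τ) : ∃ C : ℝ, 1 ≤ C ∧ ∀ k, matNorm (γ.B 0 (γ.accTime (k + 2))) ≤
      C * matNorm (γ.B 0 (γ.accTime k)) ^ (1 + τ) := by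
  -- With σ ≤ 1 and 3σ ≤ τ one has (1 + σ)² ≤ 1 + 3σ ≤ 1 + τ.
  set σ := min (τ / 3) 1 with hσ
  have hσ0 : 0 < σ := lt_min (by linarith) one_pos
  have hσ1 : σ ≤ 1 := min_le_right _ _
  have hσ3 : σ ≤ τ / 3 := min_le_left _ _
  obtain ⟨C, hC0, hC⟩ := ha σ hσ0
  set D := max C 1 with hD
  have hD1 : 1 ≤ D := le_max_right _ _
  have hD0 : 0 < D := one_pos.trans_le hD1
  have hN : ∀ k, 1 ≤ matNorm (γ.B 0 (γ.accTime k)) := fun k => γ.one_le_matNorm_B (Nat.zero_le _)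
  have step : ∀ k, matNorm (γ.B 0 (γ.accTime (k + 1))) ≤
      D * matNorm (γ.B 0 (γ.accTime k)) ^ (1 + σ) := fun k => by
    have hk := hN k
    have h1 := γ.matNorm_B_mul_le (Nat.zero_le _) (hmono k.lt_succ_self).le
    have h2 := hC k
    change _ ≤ C * matNorm (γ.B 0 (γ.accTime k)) ^ σ at h2
    refine h1.trans ?_
    rw [add_comm 1 σ, Real.rpow_add_one (by positivity), ← mul_assoc]
    refine mul_le_mul_of_nonneg_right (h2.trans ?_) (by positivity)
    exact mul_le_mul_of_nonneg_right (le_max_left _ _) (by positivity)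
  refine ⟨D * D ^ (1 + σ), one_le_mul_of_one_le_of_one_le hD1
    (Real.one_le_rpow hD1 (by linarith)), fun k => ?_⟩
  have hk := hN k
  calc matNorm (γ.B 0 (γ.accTime (k + 2)))
      ≤ D * matNorm (γ.B 0 (γ.accTime (k + 1))) ^ (1 + σ) := step (k + 1)
    _ ≤ D * (D * matNorm (γ.B 0 (γ.accTime k)) ^ (1 + σ)) ^ (1 + σ) :=
        mul_le_mul_of_nonneg_left (Real.rpow_le_rpow (zero_le_one.trans (hN _)) (step k)
          (by linarith)) hD0.le
    _ = D * D ^ (1 + σ) * matNorm (γ.B 0 (γ.accTime k)) ^ ((1 + σ) * (1 + σ)) := by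
        rw [Real.mul_rpow hD0.le (by positivity), ← Real.rpow_mul (by positivity), mul_assoc]
    _ ≤ _ := mul_le_mul_of_nonneg_left (Real.rpow_le_rpow_of_exponent_le hk (by nlinarith))
        (by positivity)

section

variable {T : IEM A}

/-- For a fixed v in the initial cone, w = B(0, n_k) v lies in H and its sum is at least a multiple
of ‖B(0, n_k)‖. The uniform lower bound applies to w and each row of B(n_k, n_{k+1}), with a
constant independent of k. -/
lemma IsRotationNumberOf.exists_le_sum_B (hT : γ.IsRotationNumberOf T) :
    ∃ c : ℝ, 0 < c ∧ ∀ (k : ℕ) (α : A),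
      c * matNorm (γ.B 0 (γ.accTime k)) ≤ ∑ β, γ.B 0 (γ.accTime (k + 1)) α β := by
  have hirr := hT.vertex_irreducible
  obtain ⟨c, hc, hbound⟩ := CombData.exists_uniform_lower_bound A
  obtain ⟨v, hvH, hv0⟩ := (hirr 0).cone_nonempty
  obtain ⟨α₁, hmin⟩ := Finite.exists_min v
  obtain ⟨α₂, hmax⟩ := Finite.exists_max v
  refine ⟨c * v α₁ / v α₂, div_pos (mul_pos hc (hv0 _)) (hv0 _), fun k α => ?_⟩
  rw [div_mul_eq_mul_div, div_le_iff₀ (hv0 α₂)]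
  obtain ⟨hlt, hcon⟩ := hT.accTime_spec k
  obtain ⟨N, hN⟩ := γ.exists_nat_B (γ.accTime k) (γ.accTime (k + 1))
  set w := (γ.B 0 (γ.accTime k)).mulVec v with hw
  have hw0 : ∀ β, 0 ≤ w β := γ.B_mulVec_nonneg fun β => (hv0 β).le
  have hlow : ∀ β, v α₁ * ∑ δ, γ.B 0 (γ.accTime k) β δ ≤ w β := fun β => by
    rw [Finset.mul_sum, hw, Matrix.mulVec, dotProduct]
    refine Finset.sum_le_sum fun δ _ => ?_
    rw [mul_comm]
    exact mul_le_mul_of_nonneg_left (hmin δ) (γ.B_nonneg _ _ _ _)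
  have hsum : v α₁ * matNorm (γ.B 0 (γ.accTime k)) ≤ ∑ β, w β := by
    rw [← le_div_iff₀' (hv0 _)]
    refine γ.matNorm_B_le fun β => ?_
    rw [le_div_iff₀' (hv0 _)]
    exact (hlow β).trans (Finset.single_le_sum (fun δ _ => hw0 δ) (Finset.mem_univ β))
  have h1 := hbound (γ.vertex (γ.accTime k)) (fun β => N α β) (fun x hx hx0 hne => by
      have := hcon.mulVec_pos hlt.le (hirr _) hx hx0 hne α
      rwa [hN] at this) w (B_mulVec_mem_H hirr (Nat.zero_le _) hvH) hw0
  have h2 : ∑ β, (N α β : ℝ) * w β = (γ.B 0 (γ.accTime (k + 1))).mulVec v α := by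
    rw [← γ.B_mul (Nat.zero_le _) hlt.le, ← Matrix.mulVec_mulVec, hN]
    rfl
  rw [h2] at h1
  have h3 : (γ.B 0 (γ.accTime (k + 1))).mulVec v α ≤
      (∑ β, γ.B 0 (γ.accTime (k + 1)) α β) * v α₂ := by
    rw [Finset.sum_mul]
    exact Finset.sum_le_sum fun δ _ => mul_le_mul_of_nonneg_left (hmax δ) (γ.B_nonneg _ _ _ _)
  calc c * v α₁ * matNorm (γ.B 0 (γ.accTime k)) = c * (v α₁ * matNorm (γ.B 0 (γ.accTime k))) :=
        mul_assoc _ _ _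
    _ ≤ c * ∑ β, w β := mul_le_mul_of_nonneg_left hsum hc.le
    _ ≤ _ := h1.trans h3

lemma IsRotationNumberOf.exists_row_bound (hT : γ.IsRotationNumberOf T) (ha : γ.ConditionA')
    {τ : ℝ} (hτ : 0 < τ) : ∃ C : ℝ, 0 < C ∧ ∀ (α : A) (n : ℕ),
      C⁻¹ * matNorm (γ.B 0 n) ^ (1 - τ) ≤ ∑ β, γ.B 0 n α β := by
  have hmono := hT.strictMono_accTime
  obtain ⟨C, hC, hgrow⟩ := ha.exists_matNorm_le hmono hτ
  obtain ⟨c, hc, hrow⟩ := hT.exists_le_sum_B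
  have hC0 : 0 < C := one_pos.trans_le hC
  have hm : 0 < min c 1 := lt_min hc one_pos
  refine ⟨C / min c 1, div_pos hC0 hm, fun α n => ?_⟩
  -- Here n_{k+1} ≤ n < n_{k+2}; if n < n_1, then k = 0 works since ‖B(0, 0)‖ = 1.
  obtain ⟨k, hk, hkr⟩ : ∃ k, n ≤ γ.accTime (k + 2) ∧
      min c 1 * matNorm (γ.B 0 (γ.accTime k)) ≤ ∑ β, γ.B 0 n α β := by
    rcases lt_or_ge n (γ.accTime 1) with h | h
    · refine ⟨0, h.le.trans (hmono.monotone (by norm_num)), ?_⟩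
      have h0 : matNorm (γ.B 0 (γ.accTime 0)) ≤ 1 := by
        refine γ.matNorm_B_le fun α => ?_
        simp [accTime, Matrix.one_apply]
      calc min c 1 * matNorm (γ.B 0 (γ.accTime 0)) ≤ 1 * 1 :=
            mul_le_mul (min_le_right _ _) h0
              (zero_le_one.trans (γ.one_le_matNorm_B (Nat.zero_le _))) zero_le_one
        _ = 1 := one_mul 1
        _ ≤ _ := γ.one_le_sum_B (Nat.zero_le _) α
    · have hex : ∃ j, n < γ.accTime j := ⟨n + 1, hmono.le_apply (x := n + 1)⟩
      have hspec := Nat.find_spec hex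
      have hmin := fun j => Nat.find_min hex (m := j)
      obtain ⟨k, hk⟩ : ∃ k, Nat.find hex = k + 2 := by
        refine ⟨Nat.find hex - 2, ?_⟩
        have : 1 < Nat.find hex := by
          by_contra hle
          exact absurd hspec (not_lt.2 ((hmono.monotone (not_lt.1 hle)).trans h))
        omega
      rw [hk] at hspec hmin
      refine ⟨k, hspec.le, ?_⟩
      refine (mul_le_mul_of_nonneg_right (min_le_left _ _)
        (zero_le_one.trans (γ.one_le_matNorm_B (Nat.zero_le _)))).trans ((hrow k α).trans ?_)
      exact γ.sum_B_mono (Nat.zero_le _) (not_lt.1 (hmin (k + 1) (by omega))) α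
  have hX := γ.one_le_matNorm_B (Nat.zero_le n)
  have hNk := γ.one_le_matNorm_B (Nat.zero_le (γ.accTime k))
  have h1 : matNorm (γ.B 0 n) ≤ C * matNorm (γ.B 0 (γ.accTime k)) ^ (1 + τ) :=
    (γ.matNorm_B_mono (Nat.zero_le _) hk).trans (hgrow k)
  have hexp : 1 - τ ≤ (1 + τ)⁻¹ := by
    rw [inv_eq_one_div, le_div_iff₀ (by linarith)]
    nlinarith
  have h2 : matNorm (γ.B 0 n) ^ (1 - τ) ≤ C * matNorm (γ.B 0 (γ.accTime k)) := by
    calc matNorm (γ.B 0 n) ^ (1 - τ) ≤ matNorm (γ.B 0 n) ^ (1 + τ)⁻¹ :=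
          Real.rpow_le_rpow_of_exponent_le hX hexp
      _ ≤ (C * matNorm (γ.B 0 (γ.accTime k)) ^ (1 + τ)) ^ (1 + τ)⁻¹ :=
          Real.rpow_le_rpow (by positivity) h1 (by positivity)
      _ = C ^ (1 + τ)⁻¹ * matNorm (γ.B 0 (γ.accTime k)) := by
          rw [Real.mul_rpow hC0.le (by positivity), Real.rpow_rpow_inv (by positivity)
            (by positivity)]
      _ ≤ C * matNorm (γ.B 0 (γ.accTime k)) := by
          refine mul_le_mul_of_nonneg_right ?_ (by positivity)
          exact Real.rpow_le_self_of_one_le hC (inv_le_one_of_one_le₀ (by linarith))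
  rw [inv_div, div_mul_eq_mul_div, div_le_iff₀ hC0]
  calc min c 1 * matNorm (γ.B 0 n) ^ (1 - τ)
      ≤ min c 1 * (C * matNorm (γ.B 0 (γ.accTime k))) := mul_le_mul_of_nonneg_left h2 hm.le
    _ = min c 1 * matNorm (γ.B 0 (γ.accTime k)) * C := by ring
    _ ≤ _ := mul_le_mul_of_nonneg_right hkr hC0.le

lemma IsRotationNumberOf.totalLen_eq (hT : γ.IsRotationNumberOf T) (n : ℕ) :
    T.totalLen = ∑ α, (∑ β, γ.B 0 n α β) * (T.iter n).len α := by
  have h : T.len = (γ.B 0 n).transpose.mulVec (T.iter n).len := hT.len_eq (Nat.zero_le n)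
  rw [IEM.totalLen, h]
  simp only [Matrix.mulVec, dotProduct, Matrix.transpose_apply, Finset.sum_mul]
  exact Finset.sum_comm

lemma IsRotationNumberOf.len_iter_nonneg (hT : γ.IsRotationNumberOf T) (n : ℕ) (α : A) :
    0 ≤ (T.iter n).len α :=
  (hT.1.iter hT.2.1 n).1.nonneg α

/-- After a positive integer matrix each entry of the column is at least the old column sum; with
two letters or more, the column sum, which is at least 1, doubles. -/
lemma exists_le_col_sum (hw : ∀ α, ∃ᶠ n in atTop, γ.winnerAt n = α) (m : ℕ) (α : A) (j : ℕ) :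
    ∃ n, m ≤ n ∧ (j : ℝ) ≤ ∑ β, γ.B m n β α := by
  induction j with
  | zero => exact ⟨m, le_rfl, by
      rw [Nat.cast_zero]; exact Finset.sum_nonneg fun β _ => γ.B_nonneg _ _ _ _⟩
  | succ j ih =>
    obtain ⟨n, hn, hj⟩ := ih
    obtain ⟨n', hn', hpos⟩ := exists_B_pos hw n
    refine ⟨n', hn.trans hn'.le, ?_⟩
    have hcol : 1 ≤ ∑ β, γ.B m n β α := by
      have h1 : ∑ β, γ.B m m β α ≤ ∑ β, γ.B m n β α :=
        Finset.sum_le_sum fun β _ => γ.B_apply_mono le_rfl hn β α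
      simpa [Matrix.one_apply] using h1
    have h2 : ∀ β, ∑ δ, γ.B m n δ α ≤ γ.B m n' β α := fun β => by
      rw [← γ.B_mul hn hn'.le, Matrix.mul_apply]
      exact Finset.sum_le_sum fun δ _ => le_mul_of_one_le_left (γ.B_nonneg _ _ _ _)
        (γ.one_le_B_of_pos (hpos β δ))
    obtain ⟨a, b, hab⟩ := exists_pair_ne A
    have h3 : γ.B m n' a α + γ.B m n' b α ≤ ∑ β, γ.B m n' β α := by
      rw [← Finset.sum_pair (f := fun β => γ.B m n' β α) hab]
      exact Finset.sum_le_sum_of_subset_of_nonneg (Finset.subset_univ _)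
        fun β _ _ => γ.B_nonneg _ _ _ _
    have := h2 a
    have := h2 b
    push_cast
    linarith

lemma IsRotationNumberOf.exists_isGreatest (hT : γ.IsRotationNumberOf T) {s : ℕ} (hs : 2 ≤ s)
    (α : A) (l : ℕ) : ∃ k, IsGreatest {k : ℕ | l ≤ k ∧
      ∑ β, γ.B (γ.accTime l) (γ.accTime k) β α < (s : ℝ)} k := by
  have hmono := hT.strictMono_accTime
  obtain ⟨n, hn, hsn⟩ := exists_le_col_sum hT.frequently_winnerAt (γ.accTime l) α s
  have hne : {k : ℕ | l ≤ k ∧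
      ∑ β, γ.B (γ.accTime l) (γ.accTime k) β α < (s : ℝ)}.Nonempty := by
    -- At k = ℓ the column sum is that of the identity, 1 < s.
    refine ⟨l, le_rfl, ?_⟩
    have : (2 : ℝ) ≤ s := by exact_mod_cast hs
    simp only [B_self, Matrix.one_apply, Finset.sum_ite_eq', Finset.mem_univ, if_true]
    linarith
  have hbdd : BddAbove {k : ℕ | l ≤ k ∧
      ∑ β, γ.B (γ.accTime l) (γ.accTime k) β α < (s : ℝ)} := by
    refine ⟨n, fun k hk => ?_⟩
    by_contra hlt
    have h1 : n ≤ γ.accTime k := (not_le.1 hlt).le.trans hmono.le_apply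
    have h2 : ∑ β, γ.B (γ.accTime l) n β α ≤ ∑ β, γ.B (γ.accTime l) (γ.accTime k) β α :=
      Finset.sum_le_sum fun β _ => γ.B_apply_mono hn h1 β α
    exact absurd hk.2 (not_lt.2 (hsn.trans h2))
  exact ⟨_, Nat.sSup_mem hne hbdd, fun k hk => le_csSup hbdd hk⟩

lemma IsRotationNumberOf.le_len_iter (hT : γ.IsRotationNumberOf T) {l k : ℕ} {α : A} (hlk : l ≤ k)
    (hs : (γ.start.numMarkedPoints : ℝ) ≤ ∑ β, γ.B (γ.accTime l) (γ.accTime (k + 1)) β α) :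
    T.totalLen ≤ matNorm (γ.B 0 (γ.accTime (k + 2))) * (T.iter (γ.accTime l)).len α := by
  have hmono := hT.strictMono_accTime
  have hirr := hT.vertex_irreducible
  obtain ⟨hlt, hcon⟩ := hT.accTime_spec (k + 1)
  have hle : γ.accTime l ≤ γ.accTime (k + 1) := hmono.monotone (by omega)
  have hB := hcon.one_le_B hirr hle hlt.le hs
  have h0 := hT.len_iter_nonneg (γ.accTime (k + 2))
  have h1 : ∑ β, (T.iter (γ.accTime (k + 2))).len β ≤ (T.iter (γ.accTime l)).len α := by
    rw [hT.len_eq (hle.trans hlt.le)]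
    simp only [Matrix.mulVec, dotProduct, Matrix.transpose_apply]
    exact Finset.sum_le_sum fun β _ => le_mul_of_one_le_left (h0 β) (hB β)
  rw [hT.totalLen_eq (γ.accTime (k + 2))]
  refine le_trans ?_ (mul_le_mul_of_nonneg_left h1
    (zero_le_one.trans (γ.one_le_matNorm_B (Nat.zero_le _))))
  rw [Finset.mul_sum]
  exact Finset.sum_le_sum fun β _ =>
    mul_le_mul_of_nonneg_right (γ.sum_B_le_matNorm _ _ β) (h0 β)

end

end RauzyPath

end IntervalExchange

end

open IntervalExchange in
/-- Let `γ` be the rotation number of an i.e.m. with no connection. Assume that `γ` satisfies condition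
(a'). Then the three estimates hold, with constants depending on `γ` and `τ` only: the lower bound for
the row sums of `B(0, n)`, the upper bound for `|I_α^{(n)}|`, and (when the number `s` of marked points
is at least `2`, so that the integer `k` exists) the lower bound for `|I_α^{(n_ℓ)}|`. -/
theorem proposition3p9 {A : Type*} [Fintype A] [DecidableEq A] [Nontrivial A]
    (γ : RauzyPath A) (hγ : ∃ T : IEM A, γ.IsRotationNumberOf T) (ha : γ.ConditionA') :
    (∀ τ : ℝ, 0 < τ → ∃ C : ℝ, 0 < C ∧ ∀ (α : A) (n : ℕ),
      C⁻¹ * matNorm (γ.B 0 n) ^ (1 - τ) ≤ ∑ β, γ.B 0 n α β) ∧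
    (∀ τ : ℝ, 0 < τ → ∃ C : ℝ, 0 < C ∧ ∀ T : IEM A, γ.IsRotationNumberOf T →
      ∀ (α : A) (n : ℕ),
        (T.iter n).len α ≤ C * T.totalLen * matNorm (γ.B 0 n) ^ (-1 + τ)) ∧
    (2 ≤ γ.start.numMarkedPoints →
      ∀ τ : ℝ, 0 < τ → ∃ C : ℝ, 0 < C ∧ ∀ T : IEM A, γ.IsRotationNumberOf T →
        ∀ (α : A) (l : ℕ), ∃ k : ℕ,
          IsGreatest {k : ℕ | l ≤ k ∧
            ∑ β, γ.B (γ.accTime l) (γ.accTime k) β α < (γ.start.numMarkedPoints : ℝ)} k ∧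
          C⁻¹ * T.totalLen * matNorm (γ.B 0 (γ.accTime k)) ^ (-τ - 1) ≤
            (T.iter (γ.accTime l)).len α) := by
  obtain ⟨T₀, hT₀⟩ := hγ
  refine ⟨fun τ hτ => hT₀.exists_row_bound ha hτ, fun τ hτ => ?_, fun hs τ hτ => ?_⟩
  · obtain ⟨C, hC, hrow⟩ := hT₀.exists_row_bound ha hτ
    refine ⟨C, hC, fun T hT α n => ?_⟩
    have hX := one_pos.trans_le (γ.one_le_matNorm_B (Nat.zero_le n))
    have h0 := hT.len_iter_nonneg n
    have h1 : (∑ β, γ.B 0 n α β) * (T.iter n).len α ≤ T.totalLen := by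
      rw [hT.totalLen_eq n]
      exact Finset.single_le_sum (f := fun α => (∑ β, γ.B 0 n α β) * (T.iter n).len α)
        (fun β _ => mul_nonneg (zero_le_one.trans (γ.one_le_sum_B (Nat.zero_le n) β)) (h0 β))
        (Finset.mem_univ α)
    have h2 := (mul_le_mul_of_nonneg_right (hrow α n) (h0 α)).trans h1
    have h3 : matNorm (γ.B 0 n) ^ (1 - τ) * matNorm (γ.B 0 n) ^ (-1 + τ) = 1 := by
      rw [← Real.rpow_add hX]
      norm_num
    have h4 := mul_le_mul_of_nonneg_left h2
      (mul_nonneg hC.le (Real.rpow_nonneg hX.le (-1 + τ)))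
    calc (T.iter n).len α
        = C * matNorm (γ.B 0 n) ^ (-1 + τ) *
          (C⁻¹ * matNorm (γ.B 0 n) ^ (1 - τ) * (T.iter n).len α) := by
          have : C * C⁻¹ = 1 := mul_inv_cancel₀ hC.ne'
          linear_combination (-(T.iter n).len α) * (C * C⁻¹ * h3 + this)
      _ ≤ _ := h4
      _ = _ := by ring
  · obtain ⟨C, hC, hgrow⟩ := ha.exists_matNorm_le hT₀.strictMono_accTime hτ
    have hC0 : 0 < C := one_pos.trans_le hC
    refine ⟨C, hC0, fun T hT α l => ?_⟩
    obtain ⟨k, hk⟩ := hT.exists_isGreatest hs α l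
    refine ⟨k, hk, ?_⟩
    have hX := one_pos.trans_le (γ.one_le_matNorm_B (Nat.zero_le (γ.accTime k)))
    have hcol : (γ.start.numMarkedPoints : ℝ) ≤
        ∑ β, γ.B (γ.accTime l) (γ.accTime (k + 1)) β α := by
      by_contra hlt
      have := hk.2 (show k + 1 ∈ _ from ⟨hk.1.1.trans k.le_succ, not_le.1 hlt⟩)
      omega
    have h1 := (hT.le_len_iter hk.1.1 hcol).trans
      (mul_le_mul_of_nonneg_right (hgrow k) (hT.len_iter_nonneg _ α))
    have h3 : matNorm (γ.B 0 (γ.accTime k)) ^ (1 + τ) *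
        matNorm (γ.B 0 (γ.accTime k)) ^ (-τ - 1) = 1 := by
      rw [← Real.rpow_add hX, show 1 + τ + (-τ - 1) = 0 by ring, Real.rpow_zero]
    have h4 := mul_le_mul_of_nonneg_left h1
      (mul_nonneg (inv_nonneg.2 hC0.le) (Real.rpow_nonneg hX.le (-τ - 1)))
    calc C⁻¹ * T.totalLen * matNorm (γ.B 0 (γ.accTime k)) ^ (-τ - 1)
        = C⁻¹ * matNorm (γ.B 0 (γ.accTime k)) ^ (-τ - 1) * T.totalLen := by ring
      _ ≤ _ := h4
      _ = (T.iter (γ.accTime l)).len α := by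
          have : C * C⁻¹ = 1 := mul_inv_cancel₀ hC0.ne'
          linear_combination ((T.iter (γ.accTime l)).len α) * (C * C⁻¹ * h3 + this)
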